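/- **Setting.** All functions are functions of $n\in\mathbb Z$ whose values are formal power series over $\mathbb C$ in the times $\mathbf t=(t_1,t_2,\dots)$. $\Lambda$ is the shift $\Lambda f(n)=f(n+1)$; difference operators are formal series $\sum_{i\in\mathbb Z}a_i(n,\mathbf t)\Lambda^i$, multiplied by $a\Lambda^i\cdot b\Lambda^j=a\,\Lambda^i(b)\,\Lambda^{i+j}$ whenever this makes sense, with adjoint $(\sum_i a_i\Lambda^i)^*=\sum_i\Lambda^{-i}a_i$. The derivative $\partial_{t_k}$ acts on coefficients. Put $(\sum_i a_i\Lambda^i)_{\ge k}=\sum_{i\ge k}a_i\Lambda^i$ (similarly $\le k$, $<k$), $(\sum_i a_i\Lambda^i)|_{\Lambda=1}=\sum_i a_i$ for finite sums, and let $\iota_{\Lambda^{\pm1}}(\Lambda-\Lambda^{-1})^{-1}$ be the expansion of $(\Lambda-\Lambda^{-1})^{-1}$ in $\mathbb C((\Lambda^{\pm1}))$. Inverses of series with powers of $\Lambda$ bounded above (below) are taken among such series. **Proposition.** Let $L^+=\sum_{j\ge-1}u_j^+(n,\mathbf t)\Lambda^{-j}$ and $L^-=\sum_{j\ge-1}u_j^-(n,\mathbf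 t)\Lambda^{j}$, where $u^+_{-1}(n,\mathbf t)$ is invertible (as a power series in $\mathbf t$) for every $n$, satisfy the large BKP Lax equations with the $B$-type constraint: for all $k\ge1$ $$\partial_{t_k}L^\pm=[B_k,L^\pm],\qquad B_k=(L^+)^k_{\ge1}-(L^-)^k_{\le-1}-\big((L^+)^k_{\ge1}-(L^-)^k_{\le-1}\big)\big|_{\Lambda=1},$$ $$(L^+)^*=(\Lambda-\Lambda^{-1})\,L^-\,\iota_{\Lambda}(\Lambda-\Lambda^{-1})^{-1}.$$ (1) There exist operators $S^+=\sum_{j\ge0}b_j(n,\mathbf t)\Lambda^{-j}$ and $S^-=\sum_{j\ge0}\Lambda^{-j}\bar b_j(n,\mathbf t)$, with $S^+$ and $(S^-)^*$ invertible, such that, for all $k\ge1$, $$L^+=S^+\Lambda(S^+)^{-1},\qquad L^-=(S^-)^*\Lambda^{-1}\big((S^-)^*\big)^{-1},\qquad S^+\Lambda^{-1}S^-=\iota_{\Lambda^{-1}}(\Lambda-\Lambda^{-1})^{-1},$$ $$\partial_{t_k}S^+=B_kS^+-S^+\Lambda^k,\qquad \partial_{t_k}S^-=\Lambda^kS^-+S^-B_k^*,$$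 $$B_k=\Big(\big(S^+\Lambda^{k-1}S^-\big)_{\ge0}+\big((S^+\Lambda^{k-1}S^-)^*\big)_{<0}\Big)(\Lambda-\Lambda^{-1}).$$ (2) Such a pair is unique exactly up to constant operators: if $(S^+,S^-)$ satisfies all the conditions in (1), then a pair $(\hat S^+,\hat S^-)$ satisfies them as well if and only if $\hat S^+=S^+C^+$ and $(\hat S^-)^*=(S^-)^*C^-$ for some $C^\pm=\sum_{j\ge0}c_j^\pm\Lambda^{\mp j}$ with constants $c_j^\pm\in\mathbb C$ (independent of $n$ and $\mathbf t$) and $C^+(C^-)^*=1$. -/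

import Mathlib

noncomputable section

namespace LargeBKP

/-- Functions of the time variables `t₁, t₂, …`: formal power series over `ℂ` in the `t_k`,
`k ≥ 1`. -/
abbrev TimeSeries : Type := MvPowerSeries ℕ+ ℂ

/-- A formal (two-sided) difference operator `∑_{i ∈ ℤ} a_i(n, t) Λ^i` in the shift
`Λ f(n) = f(n + 1)`, with all coefficients written to the left of the powers of `Λ`:
`A i n` is the coefficient `a_i(n, t)`. -/
def DiffOp : Type := ℤ → ℤ → TimeSeries

namespace DiffOp

instance : AddCommGroup DiffOp := inferInstanceAs (AddCommGroup (ℤ → ℤ → TimeSeries))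

/-- The power `Λ^j` of the shift operator. -/
def shift (j : ℤ) : DiffOp := fun i _ => if i = j then 1 else 0

/-- The operator of multiplication by the function `f(n, t)`. -/
def ofFun (f : ℤ → TimeSeries) : DiffOp := fun i n => if i = 0 then f n else 0

instance : One DiffOp := ⟨shift 0⟩

/-- Composition, `a(n) Λ^i · b(n) Λ^j = a(n) b(n + i) Λ^{i + j}` extended to series. For each
coefficient the sum has only finitely many nonzero terms if the powers of `Λ` are bounded above
in both factors, or bounded below in both factors, or if one of the factors is a finite sum;
only such products are used below. -/
instance : Mul DiffOp := ⟨fun A B m n => ∑ᶠ i : ℤ, A i n * B (m - i) (n + i)⟩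

instance : Pow DiffOp ℕ := ⟨fun A k => npowRec k A⟩

/-- The adjoint `(∑ a_i(n) Λ^i)^* = ∑ Λ^{-i} a_i(n) = ∑ a_i(n - i) Λ^{-i}`. -/
def adj (A : DiffOp) : DiffOp := fun m n => A (-m) (n + m)

/-- The derivative `∂_{t_k}`, applied to every coefficient. -/
def timeDeriv (k : ℕ+) (A : DiffOp) : DiffOp := fun i n => MvPowerSeries.pderiv ℂ k (A i n)

/-- `A_{≥ k}`. -/
def partGE (k : ℤ) (A : DiffOp) : DiffOp := fun i n => if k ≤ i then A i n else 0

/-- `A_{≤ k}`. -/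
def partLE (k : ℤ) (A : DiffOp) : DiffOp := fun i n => if i ≤ k then A i n else 0

/-- `A|_{Λ = 1}`, the function `∑_i a_i(n, t)`; only used for finite sums `A`. -/
def atOne (A : DiffOp) : ℤ → TimeSeries := fun n => ∑ᶠ i : ℤ, A i n

/-- Only powers `Λ^i` with `i ≤ N` occur. -/
def OrderLE (N : ℤ) (A : DiffOp) : Prop := ∀ i n, N < i → A i n = 0

/-- Only powers `Λ^i` with `N ≤ i` occur. -/
def OrderGE (N : ℤ) (A : DiffOp) : Prop := ∀ i n, i < N → A i n = 0

/-- `T` is the two-sided inverse of `A` among the operators whose powers of `Λ` are bounded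
above. -/
def IsInvBddAbove (A T : DiffOp) : Prop := (∃ N, OrderLE N T) ∧ A * T = 1 ∧ T * A = 1

/-- `T` is the two-sided inverse of `A` among the operators whose powers of `Λ` are bounded
below. -/
def IsInvBddBelow (A T : DiffOp) : Prop := (∃ N, OrderGE N T) ∧ A * T = 1 ∧ T * A = 1

/-- The operator `Λ - Λ⁻¹`. -/
def shiftDiff : DiffOp := shift 1 - shift (-1)

/-- `ι_{Λ⁻¹} (Λ - Λ⁻¹)⁻¹ = Λ⁻¹ + Λ⁻³ + Λ⁻⁵ + ⋯`, the expansion in `ℂ((Λ⁻¹))`. -/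
def iotaNeg : DiffOp := fun i _ => if i < 0 ∧ Odd i then 1 else 0

/-- `ι_Λ (Λ - Λ⁻¹)⁻¹ = -(Λ + Λ³ + Λ⁵ + ⋯)`, the expansion in `ℂ((Λ))`. -/
def iotaPos : DiffOp := fun i _ => if 0 < i ∧ Odd i then -1 else 0

/-- The operator `∑_{j ≥ 0} c_j Λ^{-j}` with constant coefficients `c_j ∈ ℂ`. -/
def constNeg (c : ℕ → ℂ) : DiffOp :=
  fun i _ => if i ≤ 0 then MvPowerSeries.C (c (-i).toNat) else 0

/-- The operator `∑_{j ≥ 0} c_j Λ^j` with constant coefficients `c_j ∈ ℂ`. -/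
def constPos (c : ℕ → ℂ) : DiffOp :=
  fun i _ => if 0 ≤ i then MvPowerSeries.C (c i.toNat) else 0

end DiffOp

open DiffOp

/-- The flow generator
`B_k = (L⁺)^k_{≥1} - (L⁻)^k_{≤-1} - ((L⁺)^k_{≥1} - (L⁻)^k_{≤-1})|_{Λ=1}`. -/
def flowGen (Lp Lm : DiffOp) (k : ℕ+) : DiffOp :=
  partGE 1 (Lp ^ (k : ℕ)) - partLE (-1) (Lm ^ (k : ℕ))
    - ofFun (atOne (partGE 1 (Lp ^ (k : ℕ)) - partLE (-1) (Lm ^ (k : ℕ))))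

/-- `L⁺ = ∑_{j ≥ -1} u⁺_j(n, t) Λ^{-j}` and `L⁻ = ∑_{j ≥ -1} u⁻_j(n, t) Λ^j` are Lax operators of
the large BKP hierarchy: they satisfy the Lax equations and the `B`-type constraint. -/
structure IsLaxPair (Lp Lm : DiffOp) : Prop where
  orderLE : OrderLE 1 Lp
  orderGE : OrderGE (-1) Lm
  lax_pos : ∀ k : ℕ+, timeDeriv k Lp = flowGen Lp Lm k * Lp - Lp * flowGen Lp Lm k
  lax_neg : ∀ k : ℕ+, timeDeriv k Lm = flowGen Lp Lm k * Lm - Lm * flowGen Lp Lm k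
  constraint : adj Lp = shiftDiff * Lm * iotaPos

/-- `S⁺ = ∑_{j ≥ 0} b_j(n, t) Λ^{-j}` and `S⁻ = ∑_{j ≥ 0} Λ^{-j} b̄_j(n, t)` are wave operators for
the pair `L⁺`, `L⁻`: dressing relations, constraint, Sato equations, and the expression of the
flow generators through `S⁺` and `S⁻`. -/
structure IsWavePair (Lp Lm Sp Sm : DiffOp) : Prop where
  orderLE_pos : OrderLE 0 Sp
  orderLE_neg : OrderLE 0 Sm
  dressing_pos : ∃ T, IsInvBddAbove Sp T ∧ Lp = Sp * shift 1 * T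
  dressing_neg : ∃ T, IsInvBddBelow (adj Sm) T ∧ Lm = adj Sm * shift (-1) * T
  constraint : Sp * shift (-1) * Sm = iotaNeg
  sato_pos : ∀ k : ℕ+, timeDeriv k Sp = flowGen Lp Lm k * Sp - Sp * shift (k : ℕ)
  sato_neg : ∀ k : ℕ+, timeDeriv k Sm = shift (k : ℕ) * Sm + Sm * adj (flowGen Lp Lm k)
  flowGen_eq : ∀ k : ℕ+, flowGen Lp Lm k =
    (partGE 0 (Sp * shift (((k : ℕ) : ℤ) - 1) * Sm)
      + partLE (-1) (adj (Sp * shift (((k : ℕ) : ℤ) - 1) * Sm))) * shiftDiff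

end LargeBKP

end

/-! ### Formal difference operators: products and adjoints -/

noncomputable section

namespace LargeBKP

namespace DiffOp

/-! Write `D = Λ - Λ⁻¹`, `ι = D⁻¹` expanded in `Λ⁻¹`, `L = L⁺`. The constraint says `(L⁻)^* = D L
ι`, so after taking adjoints everything happens in the ring `UpperOp` of series bounded above and is
determined by `L`. The generators become `B_k = Y_k D`, where `Y_k` is the self-adjoint operator
with the nonnegative part of `L^k ι` (`flowGen_eq`). In the zero curvature equations divided by `D`,
the left side is self-adjoint and has only negative powers, hence vanishes (`zero_curvature`).

For existence, solve `L S = S Λ` coefficient by coefficient. The defect `X_k = S⁻¹ ∂_k S - S⁻¹ B_k S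
+ Λ^k` commutes with `Λ` and has order at most zero, so it is a series in `Λ⁻¹` with coefficients
independent of `n`; zero curvature gives `∂_j X_k = ∂_k X_j`. The Poincaré lemma and the exponential
produce an invertible `C` commuting with `Λ` with `∂_k C = -X_k C`, and `S C` satisfies the Sato
equations. The constraint forces `S⁻ = Λ (S⁺)⁻¹ ι`, from which the remaining conditions follow.

For uniqueness, the quotient of two solutions commutes with `Λ` and is annihilated by every `∂_k`,
so it is a constant operator. -/

theorem ext {A B : DiffOp} (h : ∀ i n, A i n = B i n) : A = B :=
  funext fun i => funext (h i)

theorem add_apply (A B : DiffOp) (i n : ℤ) : (A + B) i n = A i n + B i n := rfl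
theorem sub_apply (A B : DiffOp) (i n : ℤ) : (A - B) i n = A i n - B i n := rfl
theorem neg_apply (A : DiffOp) (i n : ℤ) : (-A) i n = -A i n := rfl
theorem zero_apply (i n : ℤ) : (0 : DiffOp) i n = 0 := rfl
theorem one_def : (1 : DiffOp) = shift 0 := rfl
theorem mul_apply (A B : DiffOp) (m n : ℤ) :
    (A * B) m n = ∑ᶠ i : ℤ, A i n * B (m - i) (n + i) := rfl
theorem pow_succ' (A : DiffOp) (k : ℕ) : A ^ (k + 1) = A ^ k * A := rfl

theorem mul_shift_apply (A : DiffOp) (j m n : ℤ) : (A * shift j) m n = A (m - j) n := by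
  rw [mul_apply, finsum_eq_single _ (m - j)]
  · simp [shift]
  · intro x hx
    have : m - x ≠ j := by omega
    simp [shift, this]

theorem shift_mul_apply (A : DiffOp) (j m n : ℤ) : (shift j * A) m n = A (m - j) (n + j) := by
  rw [mul_apply, finsum_eq_single _ j]
  · simp [shift]
  · intro x hx
    simp [shift, hx]

/-- The substitution `i ↦ i - m` matches the summands one by one, so no boundedness is needed; this
lets the constraint, a product of series bounded below, pass to series bounded above. -/
theorem adj_mul (A B : DiffOp) : adj (A * B) = adj B * adj A := by
  refine ext fun m n => ?_
  simp only [adj, mul_apply]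
  rw [← finsum_comp_equiv (Equiv.subRight m)]
  refine finsum_congr fun i => ?_
  simp only [Equiv.subRight_apply]
  rw [mul_comm]
  congr 2 <;> ring

theorem adj_adj (A : DiffOp) : adj (adj A) = A := by
  refine ext fun m n => ?_
  simp [adj]

theorem adj_add (A B : DiffOp) : adj (A + B) = adj A + adj B := rfl
theorem adj_sub (A B : DiffOp) : adj (A - B) = adj A - adj B := rfl
theorem adj_timeDeriv (k : ℕ+) (A : DiffOp) : adj (timeDeriv k A) = timeDeriv k (adj A) := rfl

theorem adj_injective : Function.Injective adj := fun A B h => by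
  rw [← adj_adj A, h, adj_adj]

theorem adj_shift (j : ℤ) : adj (shift j) = shift (-j) := by
  refine ext fun m n => ?_
  simp only [adj, shift]
  congr 1
  simp [neg_eq_iff_eq_neg]

theorem adj_one : adj (1 : DiffOp) = 1 := by
  rw [one_def, adj_shift, neg_zero]

theorem adj_shiftDiff : adj shiftDiff = -shiftDiff := by
  rw [shiftDiff, adj_sub, adj_shift, adj_shift, neg_sub, neg_neg]

theorem adj_iotaPos : adj iotaPos = -iotaNeg := by
  refine ext fun m n => ?_
  simp only [adj, iotaPos, neg_apply, iotaNeg, Left.neg_pos_iff, odd_neg]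
  split_ifs <;> simp

theorem adj_constPos (c : ℕ → ℂ) : adj (constPos c) = constNeg c := by
  refine ext fun m n => ?_
  simp [adj, constPos, constNeg]

theorem adj_constNeg (c : ℕ → ℂ) : adj (constNeg c) = constPos c := by
  rw [← adj_constPos, adj_adj]

theorem OrderLE.adj {N : ℤ} {A : DiffOp} (h : OrderLE N A) : OrderGE (-N) A.adj :=
  fun i n hi => h _ _ (by omega)

theorem OrderGE.adj {N : ℤ} {A : DiffOp} (h : OrderGE N A) : OrderLE (-N) A.adj :=
  fun i n hi => h _ _ (by omega)

theorem OrderLE.mono {a b : ℤ} {A : DiffOp} (h : OrderLE a A) (hab : a ≤ b) : OrderLE b A :=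
  fun i n hi => h i n (by omega)

theorem orderLE_shift (j : ℤ) : OrderLE j (shift j) := fun i n hi => by
  simp [shift, hi.ne']

theorem OrderLE.add {a : ℤ} {A B : DiffOp} (hA : OrderLE a A) (hB : OrderLE a B) :
    OrderLE a (A + B) := fun i n hi => by
  rw [add_apply, hA i n hi, hB i n hi, add_zero]

theorem OrderLE.neg {a : ℤ} {A : DiffOp} (hA : OrderLE a A) : OrderLE a (-A) := fun i n hi => by
  rw [neg_apply, hA i n hi, neg_zero]

theorem OrderLE.sub {a : ℤ} {A B : DiffOp} (hA : OrderLE a A) (hB : OrderLE a B) :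
    OrderLE a (A - B) := fun i n hi => by
  rw [sub_apply, hA i n hi, hB i n hi, sub_zero]

theorem OrderLE.timeDeriv {a : ℤ} {A : DiffOp} (k : ℕ+) (hA : OrderLE a A) :
    OrderLE a (timeDeriv k A) := fun i n hi => by
  rw [DiffOp.timeDeriv, hA i n hi, map_zero]

theorem OrderLE.mul {a b : ℤ} {A B : DiffOp} (hA : OrderLE a A) (hB : OrderLE b B) :
    OrderLE (a + b) (A * B) := fun m n hm => by
  rw [mul_apply]
  refine finsum_eq_zero_of_forall_eq_zero fun i => ?_
  rcases lt_or_ge a i with h | h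
  · rw [hA i n h, zero_mul]
  · rw [hB (m - i) _ (by omega), mul_zero]

theorem mul_apply_eq_sum {a b : ℤ} {A B : DiffOp} (hA : OrderLE a A) (hB : OrderLE b B)
    (m n : ℤ) (s : Finset ℤ) (hs : ∀ i, m - b ≤ i → i ≤ a → i ∈ s) :
    (A * B) m n = ∑ i ∈ s, A i n * B (m - i) (n + i) := by
  rw [mul_apply]
  refine finsum_eq_sum_of_support_subset _ fun i hi => ?_
  rw [Function.mem_support] at hi
  refine hs i ?_ ?_
  · by_contra h
    exact hi (by rw [hB (m - i) _ (by omega), mul_zero])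
  · by_contra h
    exact hi (by rw [hA i _ (by omega), zero_mul])

/-- With all powers bounded above, each coefficient is a finite double sum over one fixed box.
Without a common bound associativity fails: `ι_Λ`, `D`, `ι_{Λ⁻¹}` is a counterexample. -/
theorem mul_assoc_of_orderLE {a b c : ℤ} {A B C : DiffOp} (hA : OrderLE a A) (hB : OrderLE b B)
    (hC : OrderLE c C) : A * B * C = A * (B * C) := by
  refine ext fun m n => ?_
  have hJ : ∀ i, m - c ≤ i → i ≤ a + b → i ∈ Finset.Icc (m - c) (a + b) := fun i h1 h2 =>
    Finset.mem_Icc.2 ⟨h1, h2⟩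
  have hI : ∀ i, m - (b + c) ≤ i → i ≤ a → i ∈ Finset.Icc (m - (b + c)) a := fun i h1 h2 =>
    Finset.mem_Icc.2 ⟨h1, h2⟩
  rw [mul_apply_eq_sum (hA.mul hB) hC m n _ hJ, mul_apply_eq_sum hA (hB.mul hC) m n _ hI]
  have h1 : ∀ j ∈ Finset.Icc (m - c) (a + b), (A * B) j n * C (m - j) (n + j) =
      ∑ i ∈ Finset.Icc (m - (b + c)) a, A i n * B (j - i) (n + i) * C (m - j) (n + j) := by
    intro j hj
    rw [Finset.mem_Icc] at hj
    rw [mul_apply_eq_sum hA hB j n _ (fun i h1 h2 => hI i (by omega) h2), Finset.sum_mul]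
  have h2 : ∀ i ∈ Finset.Icc (m - (b + c)) a, A i n * (B * C) (m - i) (n + i) =
      ∑ j ∈ Finset.Icc (m - c) (a + b), A i n * B (j - i) (n + i) * C (m - j) (n + j) := by
    intro i hi
    rw [Finset.mem_Icc] at hi
    rw [mul_apply_eq_sum hB hC (m - i) (n + i)
      ((Finset.Icc (m - c) (a + b)).map (Equiv.subRight i).toEmbedding), Finset.sum_map,
      Finset.mul_sum]
    · refine Finset.sum_congr rfl fun j _ => ?_
      simp only [Equiv.coe_toEmbedding, Equiv.subRight_apply]
      rw [mul_assoc, show m - i - (j - i) = m - j by ring, show n + i + (j - i) = n + j by ring]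
    · intro l hl1 hl2
      rw [Finset.mem_map_equiv]
      simp only [Equiv.subRight_symm_apply, Finset.mem_Icc]
      omega
  rw [Finset.sum_congr rfl h1, Finset.sum_congr rfl h2, Finset.sum_comm]

theorem mul_comm_of_const {A B : DiffOp} (hA : ∀ i n n', A i n = A i n')
    (hB : ∀ i n n', B i n = B i n') : A * B = B * A := by
  refine ext fun m n => ?_
  rw [mul_apply, mul_apply, ← finsum_comp_equiv (Equiv.subLeft m)]
  refine finsum_congr fun i => ?_
  simp only [Equiv.subLeft_apply]
  rw [mul_comm, sub_sub_cancel, hA _ n (n + i), hB _ (n + (m - i)) n]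

end DiffOp

/-! ### The differential ring of operators bounded above -/

open DiffOp

/-- The ring of difference operators with powers of `Λ` bounded above. -/
structure UpperOp where
  /-- The underlying operator. -/
  val : DiffOp
  exists_orderLE : ∃ N, OrderLE N val

namespace UpperOp

instance : CoeOut UpperOp DiffOp := ⟨UpperOp.val⟩

theorem ext {A B : UpperOp} (h : (A : DiffOp) = B) : A = B := by
  cases A
  cases B
  cases h
  rfl

instance : Zero UpperOp := ⟨⟨0, 0, fun _ _ _ => rfl⟩⟩
instance : One UpperOp := ⟨⟨1, 0, orderLE_shift 0⟩⟩
instance : Neg UpperOp := ⟨fun A => ⟨-A.1, A.2.choose, A.2.choose_spec.neg⟩⟩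
instance : Add UpperOp := ⟨fun A B => ⟨A.1 + B.1, max A.2.choose B.2.choose,
  (A.2.choose_spec.mono (le_max_left _ _)).add (B.2.choose_spec.mono (le_max_right _ _))⟩⟩
instance : Sub UpperOp := ⟨fun A B => ⟨A.1 - B.1, max A.2.choose B.2.choose,
  (A.2.choose_spec.mono (le_max_left _ _)).sub (B.2.choose_spec.mono (le_max_right _ _))⟩⟩
instance : Mul UpperOp := ⟨fun A B => ⟨A.1 * B.1, _, A.2.choose_spec.mul B.2.choose_spec⟩⟩

theorem coe_zero : ((0 : UpperOp) : DiffOp) = 0 := rfl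
theorem coe_one : ((1 : UpperOp) : DiffOp) = 1 := rfl
theorem coe_neg (A : UpperOp) : ((-A : UpperOp) : DiffOp) = -A := rfl
theorem coe_add (A B : UpperOp) : ((A + B : UpperOp) : DiffOp) = A + B := rfl
theorem coe_sub (A B : UpperOp) : ((A - B : UpperOp) : DiffOp) = A - B := rfl
theorem coe_mul (A B : UpperOp) : ((A * B : UpperOp) : DiffOp) = A * B := rfl

instance : Ring UpperOp where
  add_assoc A B C := ext (add_assoc A.1 B.1 C.1)
  zero_add A := ext (zero_add A.1)
  add_zero A := ext (add_zero A.1)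
  add_comm A B := ext (add_comm A.1 B.1)
  nsmul := nsmulRec
  zsmul := zsmulRec
  neg_add_cancel A := ext (neg_add_cancel A.1)
  sub_eq_add_neg A B := ext (sub_eq_add_neg A.1 B.1)
  mul_assoc := by
    rintro ⟨A, a, hA⟩ ⟨B, b, hB⟩ ⟨C, c, hC⟩
    exact ext (mul_assoc_of_orderLE hA hB hC)
  one_mul A := ext <| DiffOp.ext fun m n => by
    rw [coe_mul, coe_one, one_def, shift_mul_apply, sub_zero, add_zero]
  mul_one A := ext <| DiffOp.ext fun m n => by
    rw [coe_mul, coe_one, one_def, mul_shift_apply, sub_zero]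
  zero_mul A := ext <| DiffOp.ext fun m n => by
    rw [coe_mul, DiffOp.mul_apply, coe_zero]
    simp [DiffOp.zero_apply]
  mul_zero A := ext <| DiffOp.ext fun m n => by
    rw [coe_mul, DiffOp.mul_apply, coe_zero]
    simp [DiffOp.zero_apply]
  left_distrib := by
    rintro ⟨A, a, hA⟩ ⟨B, b, hB⟩ ⟨C, c, hC⟩
    refine ext <| DiffOp.ext fun m n => ?_
    have hs : ∀ i, m - max b c ≤ i → i ≤ a → i ∈ Finset.Icc (m - max b c) a :=
      fun i h1 h2 => Finset.mem_Icc.2 ⟨h1, h2⟩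
    have hB' := hB.mono (le_max_left b c)
    have hC' := hC.mono (le_max_right b c)
    change (A * (B + C)) m n = (A * B) m n + (A * C) m n
    rw [mul_apply_eq_sum hA (hB'.add hC') m n _ hs,
      mul_apply_eq_sum hA hB' m n _ hs, mul_apply_eq_sum hA hC' m n _ hs,
      ← Finset.sum_add_distrib]
    simp only [DiffOp.add_apply, mul_add]
  right_distrib := by
    rintro ⟨A, a, hA⟩ ⟨B, b, hB⟩ ⟨C, c, hC⟩
    refine ext <| DiffOp.ext fun m n => ?_
    have hs : ∀ i, m - c ≤ i → i ≤ max a b → i ∈ Finset.Icc (m - c) (max a b) :=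
      fun i h1 h2 => Finset.mem_Icc.2 ⟨h1, h2⟩
    have hA' := hA.mono (le_max_left a b)
    have hB' := hB.mono (le_max_right a b)
    change ((A + B) * C) m n = (A * C) m n + (B * C) m n
    rw [mul_apply_eq_sum (hA'.add hB') hC m n _ hs,
      mul_apply_eq_sum hA' hC m n _ hs, mul_apply_eq_sum hB' hC m n _ hs,
      ← Finset.sum_add_distrib]
    simp only [DiffOp.add_apply, add_mul]

theorem coe_pow (A : UpperOp) (k : ℕ) : ((A ^ k : UpperOp) : DiffOp) = (A : DiffOp) ^ k := by
  induction k with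
  | zero => rw [pow_zero]; rfl
  | succ k ih => rw [pow_succ, coe_mul, ih]; rfl

/-- The derivative `∂_{t_k}` of an operator with powers of `Λ` bounded above. -/
def dt (k : ℕ+) (A : UpperOp) : UpperOp :=
  ⟨timeDeriv k A.1, A.2.choose, A.2.choose_spec.timeDeriv k⟩

theorem coe_dt (k : ℕ+) (A : UpperOp) : (dt k A : DiffOp) = timeDeriv k A := rfl

theorem dt_add (k : ℕ+) (A B : UpperOp) : dt k (A + B) = dt k A + dt k B :=
  ext <| DiffOp.ext fun _ _ => map_add _ _ _

theorem dt_sub (k : ℕ+) (A B : UpperOp) : dt k (A - B) = dt k A - dt k B :=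
  ext <| DiffOp.ext fun _ _ => map_sub _ _ _

theorem dt_mul (k : ℕ+) (A B : UpperOp) :
    dt k (A * B) = dt k A * B + A * dt k B := by
  obtain ⟨A, a, hA⟩ := A
  obtain ⟨B, b, hB⟩ := B
  refine ext <| DiffOp.ext fun m n => ?_
  have hs : ∀ i, m - b ≤ i → i ≤ a → i ∈ Finset.Icc (m - b) a :=
    fun i h1 h2 => Finset.mem_Icc.2 ⟨h1, h2⟩
  change MvPowerSeries.pderiv ℂ k ((A * B) m n) = (timeDeriv k A * B) m n + (A * timeDeriv k B) m n
  rw [mul_apply_eq_sum hA hB m n _ hs, mul_apply_eq_sum (hA.timeDeriv k) hB m n _ hs,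
    mul_apply_eq_sum hA (hB.timeDeriv k) m n _ hs, map_sum, ← Finset.sum_add_distrib]
  refine Finset.sum_congr rfl fun i _ => ?_
  rw [Derivation.leibniz, smul_eq_mul, smul_eq_mul, add_comm, timeDeriv, timeDeriv,
    mul_comm (B _ _)]

theorem dt_comm (j k : ℕ+) (A : UpperOp) : dt j (dt k A) = dt k (dt j A) := by
  refine ext <| DiffOp.ext fun m n => ?_
  change MvPowerSeries.pderiv ℂ j (MvPowerSeries.pderiv ℂ k (A.1 m n)) =
    MvPowerSeries.pderiv ℂ k (MvPowerSeries.pderiv ℂ j (A.1 m n))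
  ext d
  simp only [MvPowerSeries.coeff_pderiv, Finsupp.add_apply]
  by_cases h : j = k
  · rw [h]
  · rw [Finsupp.single_eq_of_ne' h, Finsupp.single_eq_of_ne h, add_right_comm]
    push_cast
    ring

/-- The power `Λ^j` of the shift. -/
def sh (j : ℤ) : UpperOp := ⟨shift j, j, orderLE_shift j⟩

theorem coe_sh (j : ℤ) : (sh j : DiffOp) = shift j := rfl

theorem sh_zero : sh 0 = 1 := rfl

theorem sh_mul_sh (i j : ℤ) : sh i * sh j = sh (i + j) := by
  refine ext <| DiffOp.ext fun m n => ?_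
  rw [coe_mul, coe_sh, coe_sh, coe_sh, mul_shift_apply, shift, shift]
  congr 1
  simp [sub_eq_iff_eq_add]

theorem dt_sh (k : ℕ+) (j : ℤ) : dt k (sh j) = 0 := by
  refine ext <| DiffOp.ext fun m n => ?_
  change MvPowerSeries.pderiv ℂ k (shift j m n) = 0
  rw [shift]
  split_ifs
  · exact MvPowerSeries.pderiv_one
  · exact map_zero _

/-- The operator `Λ - Λ⁻¹`. -/
def D : UpperOp := sh 1 - sh (-1)

theorem coe_D : (D : DiffOp) = shiftDiff := rfl

/-- The expansion `Λ⁻¹ + Λ⁻³ + ⋯` of `(Λ - Λ⁻¹)⁻¹`. -/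
def iota : UpperOp := ⟨iotaNeg, 0, fun i n hi => by simp [iotaNeg, hi.le]⟩

theorem coe_iota : (iota : DiffOp) = iotaNeg := rfl

theorem commute_sh_of_const {A : UpperOp} (hA : ∀ i n n', A.1 i n = A.1 i n') (j : ℤ) :
    Commute (sh j) A :=
  ext (mul_comm_of_const (fun _ _ _ => rfl) hA)

/-- Comparing coefficients of `Λ^{i+1}` gives `a_i(n+1) = a_i(n)`. This centralizer measures the
freedom in dressing. -/
theorem const_of_commute_sh {A : UpperOp} (h : Commute (sh 1) A) (i n n' : ℤ) :
    A.1 i n = A.1 i n' := by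
  have key : ∀ n, A.1 i (n + 1) = A.1 i n := fun n => by
    have := congrFun (congrFun (congrArg val h.eq) (i + 1)) n
    rw [coe_mul, coe_mul, coe_sh, shift_mul_apply, mul_shift_apply] at this
    simpa using this
  have key0 : ∀ n, A.1 i n = A.1 i 0 := fun n => by
    induction n with
    | zero => rfl
    | succ n ih => rw [key, ih]
    | pred n ih => rw [← key, sub_add_cancel, ih]
  rw [key0 n, key0 n']

theorem iota_mul_D : iota * D = 1 := by
  refine ext <| DiffOp.ext fun m n => ?_
  rw [D, mul_sub, coe_sub, coe_mul, coe_mul, DiffOp.sub_apply, coe_sh, coe_sh, mul_shift_apply,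
    mul_shift_apply, coe_one, one_def, coe_iota]
  simp only [iotaNeg, shift, odd_sub_one, sub_neg_eq_add, odd_add_one]
  rcases lt_trichotomy m 0 with h | rfl | h
  · have h1 : m - 1 < 0 := by omega
    rcases eq_or_ne m (-1) with rfl | h'
    · simp
    · have h2 : m + 1 < 0 := by omega
      simp [h1, h2, h.ne]
  · simp
  · have h1 : ¬ m - 1 < 0 := by omega
    have h2 : ¬ m + 1 < 0 := by omega
    simp [h1, h2, h.ne']

theorem D_mul_iota : D * iota = 1 := by
  have h : Commute D iota := (commute_sh_of_const (fun _ _ _ => rfl) 1).sub_left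
    (commute_sh_of_const (fun _ _ _ => rfl) (-1))
  rw [h.eq, iota_mul_D]

end UpperOp

end LargeBKP

end

/-! ### Closed one-forms and exponentials of formal power series -/

noncomputable section

namespace MvPowerSeries

variable {σ K : Type*} [CommRing K] [Algebra ℚ K]

/-- The Poincaré lemma for closed formal one-forms. -/
theorem exists_pderiv_eq (f : σ → MvPowerSeries σ K)
    (hf : ∀ j k, pderiv K j (f k) = pderiv K k (f j)) :
    ∃ φ : MvPowerSeries σ K, constantCoeff φ = 0 ∧ ∀ k, pderiv K k φ = f k := by
  classical
  have hk : ∀ m : σ →₀ ℕ, m ≠ 0 → ∃ k, m k ≠ 0 := fun m hm => Finsupp.ne_iff.1 hm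
  -- The equation `∂_k φ = f_k` forces `φ_m = (f_k)_{m - e_k} / m_k` for every `k` with `m_k ≠ 0`;
  -- one such `k` is chosen, and closedness makes the choice immaterial.
  let φ : MvPowerSeries σ K := fun m => if h : m = 0 then 0 else
    algebraMap ℚ K ((m (hk m h).choose : ℚ)⁻¹) *
      coeff (m - Finsupp.single (hk m h).choose 1) (f (hk m h).choose)
  have hcφ : ∀ m, coeff m φ = φ m := fun _ => rfl
  refine ⟨φ, ?_, fun j => ?_⟩
  · rw [← coeff_zero_eq_constantCoeff_apply, hcφ]
    exact dif_pos rfl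
  ext m
  rw [coeff_pderiv]
  have hM : m + Finsupp.single j 1 ≠ 0 := by
    intro h
    have := DFunLike.congr_fun h j
    simp at this
  obtain ⟨k, hk0, hk1⟩ : ∃ k, (m + Finsupp.single j 1 : σ →₀ ℕ) k ≠ 0 ∧
      coeff (m + Finsupp.single j 1) φ =
        algebraMap ℚ K ((((m + Finsupp.single j 1 : σ →₀ ℕ) k : ℕ) : ℚ)⁻¹) *
          coeff (m + Finsupp.single j 1 - Finsupp.single k 1) (f k) :=
    ⟨(hk _ hM).choose, (hk _ hM).choose_spec, by
      rw [hcφ]; exact dif_neg hM⟩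
  rw [hk1]
  have cancel : ∀ (q : ℕ), q ≠ 0 → ∀ a : K, algebraMap ℚ K ((q : ℚ)⁻¹) * (a * q) = a := by
    intro q hq a
    rw [mul_comm, mul_assoc, ← map_natCast (algebraMap ℚ K) q, ← map_mul,
      mul_inv_cancel₀ (Nat.cast_ne_zero.2 hq), map_one, mul_one]
  by_cases hkj : k = j
  · subst hkj
    rw [add_tsub_cancel_right, mul_assoc]
    simpa using cancel (m k + 1) (Nat.succ_ne_zero _) (coeff m (f k))
  · have hmk : m k ≠ 0 := by
      simpa [Finsupp.single_eq_of_ne hkj] using hk0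
    obtain ⟨d, rfl⟩ : ∃ d, m = d + Finsupp.single k 1 :=
      ⟨m - Finsupp.single k 1, (tsub_add_cancel_of_le
        (Finsupp.single_le_iff.2 (Nat.one_le_iff_ne_zero.2 hmk))).symm⟩
    -- Closedness at `d = m - e_k` trades the chosen index `k` for `j`.
    have h := congrArg (coeff d) (hf j k)
    rw [coeff_pderiv, coeff_pderiv] at h
    rw [add_right_comm, add_tsub_cancel_right, mul_assoc]
    have e1 : (d + Finsupp.single k 1 : σ →₀ ℕ) j = d j := by
      simp [Finsupp.single_eq_of_ne (Ne.symm hkj)]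
    have e2 : (d + Finsupp.single j 1 + Finsupp.single k 1 : σ →₀ ℕ) k = d k + 1 := by
      simp [Finsupp.single_eq_of_ne hkj]
    rw [e1, e2, h]
    simpa using cancel (d k + 1) (Nat.succ_ne_zero _) (coeff (d + Finsupp.single k 1) (f j))

/-- The exponential of a formal power series without constant term. -/
theorem exists_pderiv_eq_mul_self (φ : MvPowerSeries σ K) (hφ : constantCoeff φ = 0) :
    ∃ e : MvPowerSeries σ K, constantCoeff e = 1 ∧ ∀ k, pderiv K k e = pderiv K k φ * e := by
  classical
  -- Truncated exponentials. As `φ^n` has order at least `n`, the coefficient at `m` is stable from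
  -- `N = deg m` on, which defines the limit `e`.
  let T : ℕ → MvPowerSeries σ K := fun N =>
    ∑ n ∈ Finset.range (N + 1), C (algebraMap ℚ K ((n.factorial : ℚ)⁻¹)) * φ ^ n
  have hT : ∀ N k, pderiv K k (T (N + 1)) = pderiv K k φ * T N := by
    intro N k
    simp only [T]
    rw [Finset.sum_range_succ', map_add, map_sum, Finset.mul_sum]
    simp only [pow_zero, mul_one, pderiv_C, add_zero, Derivation.leibniz,
      Derivation.leibniz_pow, smul_eq_mul, Nat.add_sub_cancel]
    refine Finset.sum_congr rfl fun n _ => ?_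
    have : algebraMap ℚ K ((n.factorial : ℚ)⁻¹) =
        algebraMap ℚ K (((n + 1).factorial : ℚ)⁻¹) * ((n + 1 : ℕ) : K) := by
      rw [← map_natCast (algebraMap ℚ K), ← map_mul, Nat.factorial_succ]
      congr 1
      have : (n.factorial : ℚ) ≠ 0 := Nat.cast_ne_zero.2 n.factorial_ne_zero
      push_cast
      field_simp
    rw [this, map_mul, nsmul_eq_mul, map_natCast]
    ring
  have hpow : ∀ (m : σ →₀ ℕ) n, m.degree < n → coeff m (φ ^ n) = 0 := fun m n h =>
    coeff_of_lt_order (lt_of_lt_of_le (by exact_mod_cast h)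
      (le_order_pow_of_constantCoeff_eq_zero n hφ))
  have hstep : ∀ (m : σ →₀ ℕ) N, m.degree ≤ N → coeff m (T (N + 1)) = coeff m (T N) := by
    intro m N h
    simp only [T]
    rw [Finset.sum_range_succ, map_add, coeff_C_mul, hpow m (N + 1) (by omega), mul_zero, add_zero]
  have hstab : ∀ (m : σ →₀ ℕ) N, m.degree ≤ N → coeff m (T N) = coeff m (T m.degree) := by
    intro m N h
    induction N, h using Nat.le_induction with
    | base => rfl
    | succ N h ih => rw [hstep m N h, ih]
  let e : MvPowerSeries σ K := fun m => coeff m (T m.degree)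
  have he : ∀ (m : σ →₀ ℕ) N, m.degree ≤ N → coeff m (T N) = coeff m e := fun m N h =>
    hstab m N h
  refine ⟨e, ?_, fun k => ?_⟩
  · rw [← coeff_zero_eq_constantCoeff_apply, ← he 0 0 (by simp)]
    simp [T]
  · ext m
    have hm : (m + Finsupp.single k 1).degree ≤ m.degree + 1 := by simp
    rw [coeff_pderiv, ← he _ _ hm, ← coeff_pderiv, hT, coeff_mul, coeff_mul]
    refine Finset.sum_congr rfl fun p hp => ?_
    rw [he p.2]
    rw [← Finset.HasAntidiagonal.mem_antidiagonal.1 hp]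
    simp

/-- A closed family of power series in `z` with coefficients in the power series ring is the
logarithmic derivative of such a power series. -/
theorem exists_pderiv_eq_sum_antidiagonal {𝕜 : Type*} [Field 𝕜] [CharZero 𝕜]
    (x : σ → ℕ → MvPowerSeries σ 𝕜)
    (hx : ∀ i j l, pderiv 𝕜 i (x j l) = pderiv 𝕜 j (x i l)) :
    ∃ c : ℕ → MvPowerSeries σ 𝕜, IsUnit (c 0) ∧
      ∀ i l, pderiv 𝕜 i (c l) = ∑ p ∈ Finset.HasAntidiagonal.antidiagonal l, x i p.1 * c p.2 := by
  classical
  -- Turning `l` into the exponent of `z` makes the convolution a product, so the Poincaré lemma and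
  -- the exponential apply over the coefficient ring `𝕜⟦z⟧`.
  let f : σ → MvPowerSeries σ (PowerSeries 𝕜) := fun i m => PowerSeries.mk fun l => coeff m (x i l)
  have hfc : ∀ i m l, PowerSeries.coeff l (coeff m (f i)) = coeff m (x i l) := fun i m l =>
    PowerSeries.coeff_mk l fun l => coeff m (x i l)
  have hq : ∀ (l : ℕ) (y : PowerSeries 𝕜) (q : ℕ),
      PowerSeries.coeff l (y * ((q : PowerSeries 𝕜) + 1)) =
        PowerSeries.coeff l y * ((q : 𝕜) + 1) := by
    intro l y q
    rw [← map_natCast (PowerSeries.C (R := 𝕜)), ← map_one (PowerSeries.C (R := 𝕜)), ← map_add,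
      PowerSeries.coeff_mul_C]
  have hf : ∀ i j, pderiv _ i (f j) = pderiv _ j (f i) := by
    intro i j
    ext m l
    have h := congrArg (coeff m) (hx i j l)
    simp only [coeff_pderiv] at h ⊢
    rw [hq, hq, hfc, hfc, h]
  obtain ⟨φ, hφ0, hφ⟩ := exists_pderiv_eq f hf
  obtain ⟨e, he0, he⟩ := exists_pderiv_eq_mul_self φ hφ0
  let c : ℕ → MvPowerSeries σ 𝕜 := fun l m => PowerSeries.coeff l (coeff m e)
  have hc : ∀ l m, coeff m (c l) = PowerSeries.coeff l (coeff m e) := fun _ _ => rfl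
  refine ⟨c, ?_, fun i l => ?_⟩
  · rw [isUnit_iff_constantCoeff, ← coeff_zero_eq_constantCoeff_apply, hc,
      coeff_zero_eq_constantCoeff_apply, he0]
    simp
  · ext m
    have h := congrArg (fun y => PowerSeries.coeff l (coeff m y)) (he i)
    rw [hφ] at h
    simp only [coeff_pderiv, hq] at h
    simp only [coeff_mul, map_sum, PowerSeries.coeff_mul, hfc] at h
    rw [coeff_pderiv, hc, map_sum]
    simp only [coeff_mul, hc]
    rw [Finset.sum_comm, ← h]

end MvPowerSeries

end

/-! ### Dressing and inversion by recursion on coefficients -/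

noncomputable section

namespace LargeBKP

open DiffOp

/-- A first-order linear recursion on `ℤ` with invertible coefficient can be solved. -/
theorem exists_eq_mul_succ_add {R : Type*} [CommRing R] (u : ℤ → R) (hu : ∀ n, IsUnit (u n))
    (r : ℤ → R) (x : R) : ∃ b : ℤ → R, b 0 = x ∧ ∀ n, b n = u n * b (n + 1) + r n := by
  choose v hv using fun n => (hu n).exists_right_inv
  -- To the right of `0` the recursion is solved for `b (n + 1)`, which needs the inverse of `u n`;
  -- to the left it is used as it stands.
  let f : ℕ → R := fun k => k.rec x fun j y => v j * (y - r j)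
  let g : ℕ → R := fun k => k.rec x fun j y => u (-(j + 1 : ℤ)) * y + r (-(j + 1 : ℤ))
  let b : ℤ → R := fun n => if 0 ≤ n then f n.toNat else g (-n).toNat
  have hf : ∀ k : ℕ, b k = f k := fun k => by simp [b]
  have hg : ∀ k : ℕ, b (-k) = g k := fun k => by
    cases k with
    | zero => simp [b, f, g]
    | succ k =>
      have h1 : ¬ (0 : ℤ) ≤ -((k + 1 : ℕ) : ℤ) := by omega
      simp only [b, if_neg h1, neg_neg, Int.toNat_natCast]
  refine ⟨b, by simp [b, f], fun n => ?_⟩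
  rcases le_or_gt 0 n with h | h
  · obtain ⟨k, rfl⟩ := Int.eq_ofNat_of_zero_le h
    have h1 : b ((k : ℤ) + 1) = v k * (b k - r k) := by
      rw [hf k]
      exact_mod_cast hf (k + 1)
    rw [h1, ← mul_assoc, hv, one_mul, sub_add_cancel]
  · obtain ⟨k, rfl⟩ : ∃ k : ℕ, n = -(k + 1 : ℕ) := ⟨(-n).toNat - 1, by omega⟩
    have h1 : b (-((k + 1 : ℕ) : ℤ) + 1) = g k := by
      rw [← hg k]
      congr 1
      push_cast
      ring
    rw [hg (k + 1), h1]
    push_cast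
    rfl

namespace UpperOp

/-- The coefficients of a dressing operator of `L`, where `solve` solves the recursion for one
coefficient, from the highest one downwards. -/
def dressingCoeff (solve : (ℤ → TimeSeries) → ℤ → TimeSeries) (L : DiffOp) (j : ℕ) :
    ℤ → TimeSeries :=
  solve (fun n => ∑ l : Fin j, L (-((l : ℕ) : ℤ)) n *
    dressingCoeff solve L (j - 1 - l) (n - (l : ℕ)))
termination_by j
decreasing_by omega

/-- An operator of order at most one whose highest coefficient is invertible can be dressed. -/
theorem exists_mul_eq_mul_sh {L : UpperOp} (hL : OrderLE 1 L.1) (hu : ∀ n, IsUnit (L.1 1 n)) :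
    ∃ S : UpperOp, OrderLE 0 S.1 ∧ (∀ n, IsUnit (S.1 0 n)) ∧ L * S = S * sh 1 := by
  choose sol hsol0 hsol using exists_eq_mul_succ_add (L.1 1) hu
  -- The recursion is the coefficient of `Λ^{1-j}` in `L S = S Λ`. The values `b_j(0)` are free;
  -- taking `b_0(0) = 1` makes the leading coefficient a unit everywhere.
  let b : ℕ → ℤ → TimeSeries := dressingCoeff (fun r => sol r 1) L.1
  have hb : ∀ j n, b j n = L.1 1 n * b j (n + 1) +
      ∑ l ∈ Finset.range j, L.1 (-(l : ℤ)) n * b (j - 1 - l) (n - l) := by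
    intro j n
    have h : b j = sol (fun n => ∑ l : Fin j, L.1 (-((l : ℕ) : ℤ)) n *
        b (j - 1 - l) (n - (l : ℕ))) 1 := by
      simp only [b]
      rw [dressingCoeff]
    conv_lhs => rw [h, hsol, ← h]
    rw [Finset.sum_range]
  have hb0 : b 0 0 = 1 := by
    simp only [b]
    rw [dressingCoeff, hsol0]
  let S : DiffOp := fun i n => if i ≤ 0 then b (-i).toNat n else 0
  have hS : OrderLE 0 S := fun i n hi => if_neg (by omega)
  refine ⟨⟨S, 0, hS⟩, hS, ?_, ?_⟩
  · have h0 : ∀ n, S 0 n = b 0 n := fun n => rfl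
    have hb' : ∀ n, b 0 n = L.1 1 n * b 0 (n + 1) := fun n => by simpa using hb 0 n
    intro n
    change IsUnit (S 0 n)
    rw [h0]
    induction n with
    | zero => rw [hb0]; exact isUnit_one
    | succ n ih => rw [hb'] at ih; exact isUnit_of_mul_isUnit_right ih
    | pred n ih =>
      rw [hb', sub_add_cancel]
      exact (hu _).mul ih
  · refine ext <| DiffOp.ext fun m n => ?_
    change (L.1 * S) m n = (S * shift 1) m n
    rw [mul_shift_apply]
    rcases lt_or_ge 1 m with hm | hm
    · rw [hS _ _ (by omega), (hL.mul hS) m n (by omega)]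
    obtain ⟨j, rfl⟩ : ∃ j : ℕ, m = 1 - j := ⟨(1 - m).toNat, by omega⟩
    have hSj : ∀ (l : ℕ) n, S (-(l : ℤ)) n = b l n := fun l n => by simp [S]
    rw [show (1 : ℤ) - j - 1 = -(j : ℤ) by ring, hSj, hb]
    let φ : ℕ ↪ ℤ := ⟨fun l => 1 - (l : ℤ), fun x y h => by simpa using h⟩
    have hφ : ∀ l : ℕ, φ l = 1 - (l : ℤ) := fun _ => rfl
    rw [mul_apply_eq_sum hL hS _ _ ((Finset.range (j + 1)).map φ)]
    · rw [Finset.sum_map, Finset.sum_range_succ', add_comm]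
      congr 1
      · simp only [hφ, Nat.cast_zero, sub_zero]
        rw [show (1 : ℤ) - j - 1 = -(j : ℤ) by ring, hSj]
      · refine Finset.sum_congr rfl fun l hl => ?_
        rw [Finset.mem_range] at hl
        simp only [hφ]
        rw [show (1 : ℤ) - ((l + 1 : ℕ) : ℤ) = -(l : ℤ) by push_cast; ring,
          show (1 : ℤ) - j - -(l : ℤ) = -((j - 1 - l : ℕ) : ℤ) by omega, hSj, ← sub_eq_add_neg]
    · intro i h1 h2
      simp only [hφ, Finset.mem_map, Finset.mem_range]
      exact ⟨(1 - i).toNat, by omega, by omega⟩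

/-- The coefficients of a right inverse, from the highest one downwards. -/
def invCoeff (v : ℤ → TimeSeries) (S : DiffOp) (j : ℕ) : ℤ → TimeSeries :=
  fun n => v n * ((if j = 0 then 1 else 0) - ∑ l : Fin j, S (-((l : ℕ) + 1 : ℤ)) n *
    invCoeff v S (j - 1 - l) (n - ((l : ℕ) + 1)))
termination_by j
decreasing_by omega

theorem exists_right_inv {S : UpperOp} (hS : OrderLE 0 S.1) (hu : ∀ n, IsUnit (S.1 0 n)) :
    ∃ T : UpperOp, OrderLE 0 T.1 ∧ (∀ n, IsUnit (T.1 0 n)) ∧ S * T = 1 := by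
  choose v hv using fun n => (hu n).exists_right_inv
  let b : ℕ → ℤ → TimeSeries := invCoeff v S.1
  -- The coefficient of `Λ^{-j}` in `S T = 1`.
  have hb : ∀ j n, S.1 0 n * b j n + ∑ l ∈ Finset.range j,
      S.1 (-((l : ℤ) + 1)) n * b (j - 1 - l) (n - (l + 1)) = if j = 0 then 1 else 0 := by
    intro j n
    conv_lhs =>
      arg 1
      simp only [b]
      rw [invCoeff, ← mul_assoc, hv, one_mul]
    rw [Finset.sum_range, sub_add_cancel]
  let T : DiffOp := fun i n => if i ≤ 0 then b (-i).toNat n else 0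
  have hT : OrderLE 0 T := fun i n hi => if_neg (by omega)
  refine ⟨⟨T, 0, hT⟩, hT, fun n => ?_, ?_⟩
  · have h0 : T 0 n = b 0 n := rfl
    change IsUnit (T 0 n)
    rw [h0]
    have := hb 0 n
    rw [Finset.sum_range_zero, add_zero, if_pos rfl] at this
    exact IsUnit.of_mul_eq_one_right _ this
  · refine ext <| DiffOp.ext fun m n => ?_
    change (S.1 * T) m n = shift 0 m n
    rcases lt_or_ge 0 m with hm | hm
    · rw [(hS.mul hT) m n (by omega), shift, if_neg hm.ne']
    obtain ⟨j, rfl⟩ : ∃ j : ℕ, m = -(j : ℤ) := ⟨(-m).toNat, by omega⟩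
    have hTj : ∀ (l : ℕ) n, T (-(l : ℤ)) n = b l n := fun l n => by simp [T]
    have hsh : shift 0 (-(j : ℤ)) n = if j = 0 then 1 else 0 := by
      simp [shift]
    rw [hsh, ← hb j n]
    let φ : ℕ ↪ ℤ := ⟨fun l => -(l : ℤ), fun x y h => by simpa using h⟩
    have hφ : ∀ l : ℕ, φ l = -(l : ℤ) := fun _ => rfl
    rw [mul_apply_eq_sum hS hT _ _ ((Finset.range (j + 1)).map φ)]
    · rw [Finset.sum_map, Finset.sum_range_succ', add_comm]
      congr 1
      · simp only [hφ, Nat.cast_zero, neg_zero]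
        rw [sub_zero, add_zero, hTj]
      · refine Finset.sum_congr rfl fun l hl => ?_
        rw [Finset.mem_range] at hl
        simp only [hφ]
        rw [show -(j : ℤ) - -((l + 1 : ℕ) : ℤ) = -((j - 1 - l : ℕ) : ℤ) by omega, hTj]
        push_cast
        rw [← sub_eq_add_neg]
    · intro i h1 h2
      simp only [hφ, Finset.mem_map, Finset.mem_range]
      exact ⟨(-i).toNat, by omega, by omega⟩

/-- The right inverse `T` again has a unit leading coefficient, hence its own right inverse, which
must be `S`. -/
theorem exists_inv {S : UpperOp} (hS : OrderLE 0 S.1) (hu : ∀ n, IsUnit (S.1 0 n)) :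
    ∃ T : UpperOp, OrderLE 0 T.1 ∧ S * T = 1 ∧ T * S = 1 := by
  obtain ⟨T, hT, huT, hST⟩ := exists_right_inv hS hu
  obtain ⟨U, -, -, hTU⟩ := exists_right_inv hT huT
  have : S = U := by rw [← mul_one S, ← hTU, ← mul_assoc, hST, one_mul]
  exact ⟨T, hT, hST, this ▸ hTU⟩

end UpperOp

end LargeBKP

end

/-! ### Self-adjoint generators and zero curvature -/

noncomputable section

namespace LargeBKP

open DiffOp

namespace DiffOp

theorem mul_shiftDiff_apply (A : DiffOp) (m n : ℤ) :
    (A * shiftDiff) m n = A (m - 1) n - A (m + 1) n := by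
  have hne : m - 1 ≠ m + 1 := by omega
  rw [mul_apply, finsum_eq_sum_of_support_subset (s := {m - 1, m + 1}), Finset.sum_pair hne]
  · simp [shiftDiff, sub_apply, shift, sub_eq_add_neg]
  · intro i hi
    by_contra h
    simp only [Finset.coe_insert, Finset.coe_singleton, Set.mem_insert_iff,
      Set.mem_singleton_iff, not_or] at h
    have h1 : m - i ≠ 1 := by omega
    have h2 : m - i ≠ -1 := by omega
    exact hi (by simp [shiftDiff, sub_apply, shift, h1, h2])

/-- The self-adjoint operator with the same nonnegative part as `P`. -/
def symPart (P : DiffOp) : DiffOp := partGE 0 P + partLE (-1) (adj P)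

theorem symPart_apply_of_nonneg (P : DiffOp) {i : ℤ} (hi : 0 ≤ i) (n : ℤ) :
    symPart P i n = P i n := by
  have h : ¬ i ≤ -1 := by omega
  simp [symPart, add_apply, partGE, partLE, hi, h]

theorem symPart_apply_of_nonpos (P : DiffOp) {i : ℤ} (hi : i ≤ 0) (n : ℤ) :
    symPart P i n = adj P i n := by
  rcases hi.eq_or_lt with rfl | h
  · rw [symPart_apply_of_nonneg P le_rfl]
    simp [adj]
  · have h1 : i ≤ -1 := by omega
    have h2 : ¬ 0 ≤ i := by omega
    simp [symPart, add_apply, partGE, partLE, h1, h2]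

theorem adj_symPart (P : DiffOp) : adj (symPart P) = symPart P := by
  refine ext fun i n => ?_
  rcases le_total 0 i with h | h
  · rw [adj, symPart_apply_of_nonpos P (by omega), symPart_apply_of_nonneg P h]
    simp [adj]
  · rw [adj, symPart_apply_of_nonneg P (by omega), symPart_apply_of_nonpos P h]
    rfl

theorem OrderLE.symPart {N : ℤ} {P : DiffOp} (hP : OrderLE N P) :
    OrderLE (max N 0) (symPart P) := fun i n hi => by
  rw [symPart_apply_of_nonneg P (by omega), hP _ _ (by omega)]

theorem orderLE_symPart_sub (P : DiffOp) : OrderLE (-1) (DiffOp.symPart P - P) := fun i n hi => by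
  rw [sub_apply, symPart_apply_of_nonneg P (by omega), sub_self]

/-- Self-adjointness turns the upper bound on powers into a lower bound. -/
theorem finite_support_of_adj_eq {N : ℤ} {A : DiffOp} (hA : OrderLE N A) (h : adj A = A) (n : ℤ) :
    (fun i => A i n).HasFiniteSupport := by
  refine (Set.finite_Icc (-N) N).subset fun i hi => ?_
  rw [Function.mem_support] at hi
  refine ⟨?_, ?_⟩
  · by_contra h'
    rw [← h] at hi
    exact hi (hA _ _ (by omega))
  · by_contra h'
    exact hi (hA _ _ (by omega))

theorem finite_support_mul_shiftDiff {A : DiffOp} {n : ℤ}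
    (hA : (fun i => A i n).HasFiniteSupport) : (fun i => (A * shiftDiff) i n).HasFiniteSupport := by
  simp only [mul_shiftDiff_apply]
  exact (hA.comp_of_injective (sub_left_injective (b := (1 : ℤ)))).sub
    (hA.comp_of_injective (add_left_injective (1 : ℤ)))

/-- The two shifted copies of the finite sum cancel. This is why right multiples of `D` meet the
normalization of `B_k`. -/
theorem atOne_mul_shiftDiff {A : DiffOp} {n : ℤ} (hA : (fun i => A i n).HasFiniteSupport) :
    atOne (A * shiftDiff) n = 0 := by
  simp only [atOne, mul_shiftDiff_apply]
  have h1 : ∑ᶠ i : ℤ, A (i - 1) n = ∑ᶠ i, A i n :=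
    finsum_comp_equiv (Equiv.subRight (1 : ℤ)) (f := fun i => A i n)
  have h2 : ∑ᶠ i : ℤ, A (i + 1) n = ∑ᶠ i, A i n :=
    finsum_comp_equiv (Equiv.addRight (1 : ℤ)) (f := fun i => A i n)
  refine (finsum_sub_distrib (hA.comp_of_injective (sub_left_injective (b := (1 : ℤ))))
    (hA.comp_of_injective (add_left_injective (1 : ℤ)))).trans ?_
  change ∑ᶠ i : ℤ, A (i - 1) n - ∑ᶠ i : ℤ, A (i + 1) n = 0
  rw [h1, h2, sub_self]

/-- Removing the term of order zero of a multiple of `Λ - Λ⁻¹` and restoring it by the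
normalization `B|_{Λ = 1} = 0`. -/
theorem sub_ofFun_atOne_eq {A Z : DiffOp} (hA : ∀ n, (fun i => A i n).HasFiniteSupport)
    (hZ : ∀ i n, i ≠ 0 → Z i n = (A * shiftDiff) i n) (hZ0 : ∀ n, Z 0 n = 0) :
    Z - ofFun (atOne Z) = A * shiftDiff := by
  -- `Z` is `A D` without its order-zero term, and `A D` vanishes at `Λ = 1`.
  have hat : ∀ n, atOne Z n = -(A * shiftDiff) 0 n := by
    intro n
    have h1 : ∀ i, Z i n = (A * shiftDiff) i n - if i = 0 then (A * shiftDiff) 0 n else 0 := by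
      intro i
      split_ifs with h
      · rw [h, hZ0, sub_self]
      · rw [hZ i n h, sub_zero]
    have h2 : (fun i : ℤ => if i = 0 then (A * shiftDiff) 0 n else 0).HasFiniteSupport :=
      (Set.finite_singleton 0).subset fun i hi => by
        by_contra h
        exact hi (if_neg h)
    have h3 := atOne_mul_shiftDiff (hA n)
    rw [atOne] at h3 ⊢
    rw [finsum_congr h1, finsum_sub_distrib (finite_support_mul_shiftDiff (hA n)) h2, h3, zero_sub,
      finsum_eq_single _ 0 fun i hi => if_neg hi, if_pos rfl]
  refine ext fun i n => ?_
  rw [sub_apply, ofFun]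
  split_ifs with h
  · rw [h, hZ0, hat, zero_sub, neg_neg]
  · rw [sub_zero, hZ i n h]

end DiffOp

namespace UpperOp

theorem orderLE_D : OrderLE 1 D.1 :=
  (orderLE_shift 1).sub ((orderLE_shift (-1)).mono (by norm_num))

theorem orderLE_iota : OrderLE (-1) iota.1 := fun i n hi => by
  have : ¬ i < 0 := by omega
  simp [iota, iotaNeg, this]

/-- The self-adjoint operator with the same nonnegative part as `P`. -/
def symPart (P : UpperOp) : UpperOp :=
  ⟨DiffOp.symPart P.1, _, P.2.choose_spec.symPart⟩

end UpperOp

open UpperOp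

namespace IsLaxPair

variable {Lp Lm : DiffOp}

/-- The operator `L⁺` in the ring of operators with powers of `Λ` bounded above. -/
def pos (hL : IsLaxPair Lp Lm) : UpperOp := ⟨Lp, 1, hL.orderLE⟩

/-- The adjoint of `L⁻`. -/
def negAdj (hL : IsLaxPair Lp Lm) : UpperOp := ⟨adj Lm, 1, hL.orderGE.adj⟩

/-- The self-adjoint operators `Y_k` with `B_k = Y_k (Λ - Λ⁻¹)`. -/
def gen (hL : IsLaxPair Lp Lm) (k : ℕ+) : UpperOp := UpperOp.symPart (hL.pos ^ (k : ℕ) * iota)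

theorem adj_gen (hL : IsLaxPair Lp Lm) (k : ℕ+) : adj (hL.gen k).1 = (hL.gen k).1 :=
  adj_symPart _

/-- The adjoint of the constraint is `L⁺ = ι (L⁻)^* D`: the signs from `D^* = -D` and `(ι_Λ)^* = -ι`
cancel. -/
theorem negAdj_eq (hL : IsLaxPair Lp Lm) : hL.negAdj = D * hL.pos * iota := by
  have h : hL.pos = iota * (hL.negAdj * D) := by
    refine UpperOp.ext ?_
    have h := congrArg adj hL.constraint
    have e1 : adj iotaPos = (-iota : UpperOp).1 := adj_iotaPos
    have e2 : adj shiftDiff = (-D : UpperOp).1 := adj_shiftDiff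
    rw [adj_adj, DiffOp.adj_mul, DiffOp.adj_mul, e1, e2] at h
    have e3 : Lp = (-iota * (hL.negAdj * -D) : UpperOp).1 := h
    rw [mul_neg, neg_mul_neg] at e3
    exact e3
  rw [h, ← mul_assoc, D_mul_iota, one_mul, mul_assoc, D_mul_iota, mul_one]

theorem negAdj_pow (hL : IsLaxPair Lp Lm) (k : ℕ) :
    hL.negAdj ^ k = D * hL.pos ^ k * iota := by
  induction k with
  | zero => rw [pow_zero, pow_zero, mul_one, D_mul_iota]
  | succ k ih =>
    rw [pow_succ, ih, negAdj_eq, pow_succ]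
    simp only [mul_assoc]
    rw [← mul_assoc iota D, iota_mul_D, one_mul]

theorem adj_negAdj_pow (hL : IsLaxPair Lp Lm) (k : ℕ) : adj (hL.negAdj ^ k).1 = Lm ^ k := by
  induction k with
  | zero => exact adj_one
  | succ k ih =>
    rw [_root_.pow_succ', UpperOp.coe_mul, DiffOp.adj_mul, ih, DiffOp.pow_succ']
    congr 1
    exact adj_adj Lm

/-- With `P = (L⁺)^k ι`, one has `(L⁺)^k = P D` and `-(L⁻)^k = P^* D`. The coefficient of `Λ^m` in
`A D` involves only `A_{m-1}` and `A_{m+1}`, so `Y_k D` agrees with the former for `m ≥ 1` and with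
the latter for `m ≤ -1`; the normalization at `Λ = 1` fixes order zero. -/
theorem flowGen_eq (hL : IsLaxPair Lp Lm) (k : ℕ+) :
    flowGen Lp Lm k = (hL.gen k * D).1 := by
  set P : UpperOp := hL.pos ^ (k : ℕ) * iota with hP
  have hfin : ∀ n, (fun i => (hL.gen k).1 i n).HasFiniteSupport := fun n =>
    finite_support_of_adj_eq (hL.gen k).2.choose_spec (hL.adj_gen k) n
  have hPD : P * D = hL.pos ^ (k : ℕ) := by
    rw [hP, mul_assoc, iota_mul_D, mul_one]
  have hpos : Lp ^ (k : ℕ) = P.1 * shiftDiff := by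
    rw [← coe_D, ← UpperOp.coe_mul, hPD, coe_pow]
    rfl
  have hneg : -Lm ^ (k : ℕ) = adj P.1 * shiftDiff := by
    rw [← hL.adj_negAdj_pow, negAdj_pow, mul_assoc, ← hP, UpperOp.coe_mul, DiffOp.adj_mul, coe_D,
      adj_shiftDiff]
    refine DiffOp.ext fun i n => ?_
    rw [DiffOp.neg_apply, DiffOp.mul_apply, DiffOp.mul_apply, ← finsum_neg_distrib]
    simp only [DiffOp.neg_apply, mul_neg, neg_neg]
  refine sub_ofFun_atOne_eq hfin (fun i n hi => ?_) fun n => ?_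
  · rw [mul_shiftDiff_apply, DiffOp.sub_apply, partGE, partLE]
    rcases lt_or_gt_of_ne hi with h | h
    · rw [if_neg (by omega), if_pos (by omega), zero_sub, ← DiffOp.neg_apply, hneg,
        mul_shiftDiff_apply]
      congr 1
      · exact (symPart_apply_of_nonpos P.1 (by omega) n).symm
      · exact (symPart_apply_of_nonpos P.1 (by omega) n).symm
    · rw [if_pos (by omega), if_neg (by omega), sub_zero, hpos, mul_shiftDiff_apply]
      congr 1
      · exact (symPart_apply_of_nonneg P.1 (by omega) n).symm
      · exact (symPart_apply_of_nonneg P.1 (by omega) n).symm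
  · rw [DiffOp.sub_apply, partGE, partLE, if_neg (by omega), if_neg (by omega), sub_zero]

theorem adj_flowGen (hL : IsLaxPair Lp Lm) (k : ℕ+) :
    adj (flowGen Lp Lm k) = (-(D * hL.gen k) : UpperOp).1 := by
  rw [hL.flowGen_eq, UpperOp.coe_mul, DiffOp.adj_mul, adj_gen, coe_D, adj_shiftDiff, ← neg_mul]
  rfl

theorem dt_pos (hL : IsLaxPair Lp Lm) (k : ℕ+) :
    dt k hL.pos = hL.gen k * D * hL.pos - hL.pos * (hL.gen k * D) := by
  refine UpperOp.ext ?_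
  have h := hL.lax_pos k
  rw [hL.flowGen_eq] at h
  exact h

theorem dt_pos_pow (hL : IsLaxPair Lp Lm) (k : ℕ+) (j : ℕ) :
    dt k (hL.pos ^ j) = hL.gen k * D * hL.pos ^ j - hL.pos ^ j * (hL.gen k * D) := by
  induction j with
  | zero =>
    rw [pow_zero, mul_one, one_mul, sub_self]
    exact dt_sh k 0
  | succ j ih =>
    rw [pow_succ, dt_mul, ih, dt_pos]
    noncomm_ring

/-- `Y_k` differs from `(L⁺)^k ι` only in negative powers, and `D` raises the order by one. -/
theorem orderLE_gen_mul_D_sub (hL : IsLaxPair Lp Lm) (k : ℕ+) :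
    OrderLE 0 (hL.gen k * D - hL.pos ^ (k : ℕ)).1 := by
  have h : hL.gen k * D - hL.pos ^ (k : ℕ) = (hL.gen k - hL.pos ^ (k : ℕ) * iota) * D := by
    rw [sub_mul, mul_assoc _ iota, iota_mul_D, mul_one]
  rw [h]
  exact (orderLE_symPart_sub (hL.pos ^ (k : ℕ) * iota).1).mul orderLE_D

/-- The zero curvature equations, divided by `Λ - Λ⁻¹`. -/
theorem zero_curvature (hL : IsLaxPair Lp Lm) (j k : ℕ+) :
    dt j (hL.gen k) - dt k (hL.gen j) + hL.gen k * D * hL.gen j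
      - hL.gen j * D * hL.gen k = 0 := by
  set G := dt j (hL.gen k) - dt k (hL.gen j) + hL.gen k * D * hL.gen j
      - hL.gen j * D * hL.gen k with hG
  have hder : ∀ i l : ℕ+, dt i (hL.gen l * D) = dt i (hL.gen l) * D := by
    intro i l
    have hD : dt i D = 0 := by rw [D, dt_sub, dt_sh, dt_sh, sub_zero]
    rw [dt_mul, hD, mul_zero, add_zero]
  have hcomm : hL.pos ^ (k : ℕ) * hL.pos ^ (j : ℕ) = hL.pos ^ (j : ℕ) * hL.pos ^ (k : ℕ) := by
    rw [← pow_add, ← pow_add, add_comm]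
  -- With `A_k = B_k - L^k`, the Lax equations and `[L^j, L^k] = 0` cancel every other term, leaving
  -- the curvature of the `A_k`, of order at most zero.
  have hGD : G * D =
      (hL.gen k * D - hL.pos ^ (k : ℕ)) * (hL.gen j * D - hL.pos ^ (j : ℕ)) -
      (hL.gen j * D - hL.pos ^ (j : ℕ)) * (hL.gen k * D - hL.pos ^ (k : ℕ)) +
      dt j (hL.gen k * D - hL.pos ^ (k : ℕ)) - dt k (hL.gen j * D - hL.pos ^ (j : ℕ)) := by
    rw [dt_sub, dt_sub, hder, hder, dt_pos_pow, dt_pos_pow, hG]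
    simp only [sub_mul, mul_sub, add_mul, hcomm, mul_assoc]
    abel
  have hk := hL.orderLE_gen_mul_D_sub k
  have hj := hL.orderLE_gen_mul_D_sub j
  have hGDo : OrderLE 0 (G * D).1 := by
    rw [hGD]
    have h1 := hk.mul hj
    have h2 := hj.mul hk
    exact ((h1.sub h2).add (hk.timeDeriv j)).sub (hj.timeDeriv k)
  have hGo : OrderLE (-1) G.1 := by
    have : G = G * D * iota := by rw [mul_assoc, D_mul_iota, mul_one]
    rw [this]
    exact hGDo.mul orderLE_iota
  have hadj3 : ∀ a b : ℕ+, adj (hL.gen a * D * hL.gen b).1 = (-(hL.gen b * D * hL.gen a)).1 := by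
    intro a b
    rw [UpperOp.coe_mul, UpperOp.coe_mul, DiffOp.adj_mul, DiffOp.adj_mul, adj_gen, adj_gen, coe_D,
      adj_shiftDiff]
    change (hL.gen b * (-D * hL.gen a) : UpperOp).1 = _
    rw [neg_mul, mul_neg, mul_assoc]
  -- Self-adjointness carries the vanishing of nonnegative powers over to the negative ones.
  have hadj : adj G.1 = G.1 := by
    have : adj G.1 = (dt j (hL.gen k) - dt k (hL.gen j) + -(hL.gen j * D * hL.gen k)
      - -(hL.gen k * D * hL.gen j) : UpperOp).1 := by
      rw [hG]
      simp only [UpperOp.coe_sub, UpperOp.coe_add, DiffOp.adj_sub, DiffOp.adj_add, hadj3, coe_dt,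
        adj_timeDeriv, adj_gen]
    rw [this, hG]
    congr 1
    abel
  refine UpperOp.ext <| DiffOp.ext fun i n => ?_
  rw [UpperOp.coe_zero, DiffOp.zero_apply]
  rcases lt_or_ge (-1) i with h | h
  · exact hGo i n h
  · rw [← hadj]
    exact hGo _ _ (by omega)

end IsLaxPair

end LargeBKP

end

/-! ### Wave operators: existence and uniqueness -/

noncomputable section

namespace LargeBKP

open DiffOp UpperOp

namespace UpperOp

theorem dt_inv {S T : UpperOp} (hTS : T * S = 1) (hST : S * T = 1) (k : ℕ+) :
    dt k T = -(T * dt k S * T) := by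
  have h := congrArg (dt k) hTS
  have h1 : dt k (1 : UpperOp) = 0 := dt_sh k 0
  rw [dt_mul, h1] at h
  rw [← eq_neg_iff_add_eq_zero] at h
  rw [← mul_one (dt k T), ← hST, ← mul_assoc, h, neg_mul]

/-- The operator `∑_{j ≥ 0} c_j Λ^{-j}` with coefficients independent of `n`. -/
def ofCoeff (c : ℕ → TimeSeries) : UpperOp :=
  ⟨fun i _ => if i ≤ 0 then c (-i).toNat else 0, 0, fun _ _ hi => if_neg (by omega)⟩

theorem orderLE_ofCoeff (c : ℕ → TimeSeries) : OrderLE 0 (ofCoeff c).1 :=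
  fun _ _ hi => if_neg (by omega)

theorem ofCoeff_apply (c : ℕ → TimeSeries) (l : ℕ) (n : ℤ) : (ofCoeff c).1 (-(l : ℤ)) n = c l := by
  simp [ofCoeff]

theorem commute_sh_ofCoeff (c : ℕ → TimeSeries) (j : ℤ) : Commute (sh j) (ofCoeff c) :=
  commute_sh_of_const (fun _ _ _ => rfl) j

theorem eq_ofCoeff {A : UpperOp} (hA : OrderLE 0 A.1) (h : Commute (sh 1) A) :
    A = ofCoeff fun l => A.1 (-(l : ℤ)) 0 := by
  refine UpperOp.ext <| DiffOp.ext fun m n => ?_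
  rcases lt_or_ge 0 m with hm | hm
  · rw [hA m n hm, orderLE_ofCoeff _ m n hm]
  · obtain ⟨j, rfl⟩ : ∃ j : ℕ, m = -(j : ℤ) := ⟨(-m).toNat, by omega⟩
    rw [ofCoeff_apply, const_of_commute_sh h _ n 0]

theorem ofCoeff_mul_ofCoeff_apply (c d : ℕ → TimeSeries) (l : ℕ) (n : ℤ) :
    (ofCoeff c * ofCoeff d).1 (-(l : ℤ)) n =
      ∑ p ∈ Finset.HasAntidiagonal.antidiagonal l, c p.1 * d p.2 := by
  let φ : ℕ ↪ ℤ := ⟨fun l => -(l : ℤ), fun x y h => by simpa using h⟩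
  have hφ : ∀ l : ℕ, φ l = -(l : ℤ) := fun _ => rfl
  rw [UpperOp.coe_mul, mul_apply_eq_sum (orderLE_ofCoeff c) (orderLE_ofCoeff d) _ _
    ((Finset.range (l + 1)).map φ), Finset.Nat.sum_antidiagonal_eq_sum_range_succ_mk,
    Finset.sum_map]
  · refine Finset.sum_congr rfl fun j hj => ?_
    rw [Finset.mem_range] at hj
    rw [hφ, ofCoeff_apply, show -(l : ℤ) - -(j : ℤ) = -((l - j : ℕ) : ℤ) by omega, ofCoeff_apply]
  · intro i h1 h2
    simp only [hφ, Finset.mem_map, Finset.mem_range]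
    exact ⟨(-i).toNat, by omega, by omega⟩

/-- Commuting with `Λ` removes the dependence on `n`, vanishing derivatives that on the times. -/
theorem eq_constNeg {A : UpperOp} (hA : OrderLE 0 A.1) (h : Commute (sh 1) A)
    (hd : ∀ k, dt k A = 0) : ∃ c, A.1 = constNeg c := by
  refine ⟨fun l => MvPowerSeries.constantCoeff (A.1 (-(l : ℤ)) 0), ?_⟩
  rw [eq_ofCoeff hA h]
  refine DiffOp.ext fun i n => ?_
  change (if i ≤ 0 then _ else _) = if i ≤ 0 then _ else _
  split_ifs with hi
  · refine MvPowerSeries.pderiv.ext (fun k => ?_) ?_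
    · rw [MvPowerSeries.pderiv_C]
      exact congrFun (congrFun (congrArg val (hd k)) _) _
    · rw [MvPowerSeries.constantCoeff_C, ← eq_ofCoeff hA h]
  · rfl

theorem orderLE_constNeg (c : ℕ → ℂ) : OrderLE 0 (constNeg c) := fun _ _ hi => if_neg (by omega)

/-- The operator `∑_{j ≥ 0} c_j Λ^{-j}` with constant coefficients. -/
def constOp (c : ℕ → ℂ) : UpperOp := ⟨constNeg c, 0, orderLE_constNeg c⟩

theorem dt_constOp (k : ℕ+) (c : ℕ → ℂ) : dt k (constOp c) = 0 := by
  refine UpperOp.ext <| DiffOp.ext fun i n => ?_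
  change MvPowerSeries.pderiv ℂ k (if i ≤ 0 then _ else _) = 0
  split_ifs
  · exact MvPowerSeries.pderiv_C
  · exact map_zero _

theorem commute_sh_constOp (c : ℕ → ℂ) (j : ℤ) : Commute (sh j) (constOp c) :=
  commute_sh_of_const (fun _ _ _ => rfl) j

theorem commute_sh_of_commute_sh_one {A : UpperOp} (h : Commute (sh 1) A) (j : ℤ) :
    Commute (sh j) A :=
  commute_sh_of_const (const_of_commute_sh h) j

end UpperOp

namespace IsLaxPair

variable {Lp Lm : DiffOp}

/-- Dressing of `L⁺` by a solution of the linear equations `∂_{t_k} S = B_k S - S Λ^k`. -/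
structure IsDressing (hL : IsLaxPair Lp Lm) (S T : UpperOp) : Prop where
  orderLE : OrderLE 0 S.1
  mul_inv : S * T = 1
  inv_mul : T * S = 1
  dressing : hL.pos * S = S * sh 1
  sato : ∀ k : ℕ+, dt k S = hL.gen k * D * S - S * sh (k : ℕ)

/-- By the Lax equation `∂_k - B_k` commutes with `L`; conjugation by `S` turns `L` into `Λ`. -/
theorem commute_logDeriv (hL : IsLaxPair Lp Lm) {S T : UpperOp} (hTS : T * S = 1)
    (hST : S * T = 1) (hLS : hL.pos * S = S * sh 1) (k : ℕ+) :
    Commute (sh 1) (T * dt k S - T * (hL.gen k * D) * S + sh (k : ℕ)) := by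
  have hTL : T * hL.pos = sh 1 * T := by
    calc T * hL.pos = T * (hL.pos * S) * T := by rw [mul_assoc, mul_assoc, hST, mul_one]
      _ = sh 1 * T := by rw [hLS, ← mul_assoc, hTS, one_mul]
  have h := congrArg (fun A => T * dt k A) hLS
  have hsh : Commute (sh 1) (sh (k : ℕ)) := by
    rw [Commute, SemiconjBy, sh_mul_sh, sh_mul_sh, add_comm]
  simp only [dt_mul, dt_sh, mul_zero, add_zero, dt_pos] at h
  have h1 : T * ((hL.gen k * D * hL.pos - hL.pos * (hL.gen k * D)) * S + hL.pos * dt k S) =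
      T * (hL.gen k * D) * (hL.pos * S) - T * hL.pos * (hL.gen k * D) * S
        + T * hL.pos * dt k S := by
    noncomm_ring
  rw [h1, hLS, hTL] at h
  rw [Commute, SemiconjBy, mul_add, add_mul, hsh.eq]
  congr 1
  rw [mul_sub, sub_mul, mul_assoc T (dt k S), ← h]
  noncomm_ring

/-- Equating the two mixed derivatives of `S`, zero curvature removes the `B` terms and
commutativity of the `X_k` the quadratic ones. -/
theorem dt_logDeriv (hL : IsLaxPair Lp Lm) {S T : UpperOp} (hTS : T * S = 1)
    {X : ℕ+ → UpperOp} (hcomm : ∀ j k, X j * X k = X k * X j) (hsh : ∀ j k, Commute (sh j) (X k))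
    (hX : ∀ k : ℕ+, dt k S = S * X k + hL.gen k * D * S - S * sh (k : ℕ)) (j k : ℕ+) :
    dt j (X k) = dt k (X j) := by
  have hD : ∀ i, dt i D = 0 := fun i => by rw [D, dt_sub, dt_sh, dt_sh, sub_zero]
  have h := dt_comm j k S
  have hss : sh (j : ℕ) * sh (k : ℕ) = sh (k : ℕ) * sh (j : ℕ) := by
    rw [sh_mul_sh, sh_mul_sh, add_comm]
  have hz : (dt j (hL.gen k) - dt k (hL.gen j) + hL.gen k * D * hL.gen j
      - hL.gen j * D * hL.gen k) * D * S = 0 := by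
    rw [hL.zero_curvature, zero_mul, zero_mul]
  rw [hX, hX] at h
  simp only [dt_sub, dt_add, dt_mul, hD, dt_sh, mul_zero, add_zero] at h
  rw [hX, hX] at h
  have key : S * dt j (X k) - S * dt k (X j) = 0 := by
    rw [← sub_eq_zero] at h
    refine Eq.trans ?_ (sub_eq_zero.2 (h.trans hz.symm))
    simp only [sub_mul, mul_sub, add_mul, mul_add, mul_assoc, (hsh _ _).eq, hcomm j k, hss]
    abel
  have := congrArg (T * ·) key
  simp only [mul_sub, ← mul_assoc, hTS, one_mul, mul_zero] at this
  exact sub_eq_zero.1 this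

theorem exists_isDressing (hL : IsLaxPair Lp Lm) (hu : ∀ n, IsUnit (Lp 1 n)) :
    ∃ S T : UpperOp, OrderLE 0 T.1 ∧ hL.IsDressing S T := by
  obtain ⟨S, hS, huS, hLS⟩ := exists_mul_eq_mul_sh (L := hL.pos) hL.orderLE hu
  obtain ⟨T, hT, hST, hTS⟩ := exists_inv hS huS
  let X : ℕ+ → UpperOp := fun k => T * dt k S - T * (hL.gen k * D) * S + sh (k : ℕ)
  have hXsh : ∀ k, Commute (sh 1) (X k) := fun k => hL.commute_logDeriv hTS hST hLS k
  have hLSk : ∀ k : ℕ, hL.pos ^ k * S = S * sh k := by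
    intro k
    induction k with
    | zero => rw [pow_zero, one_mul]; exact (mul_one S).symm
    | succ k ih =>
      rw [pow_succ, mul_assoc, hLS, ← mul_assoc, ih, mul_assoc, sh_mul_sh]
      push_cast
      rfl
  -- Since `S⁻¹ L^k S = Λ^k`, only `B_k - L^k`, of order at most zero, contributes.
  have hXo : ∀ k, OrderLE 0 (X k).1 := by
    intro k
    have h1 : X k = T * dt k S - T * (hL.gen k * D - hL.pos ^ (k : ℕ)) * S := by
      simp only [X]
      rw [mul_sub, sub_mul, mul_assoc T (hL.pos ^ (k : ℕ)), hLSk, ← mul_assoc T S, hTS, one_mul]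
      abel
    rw [h1]
    have h2 := hT.mul (hS.timeDeriv k)
    have h3 := (hT.mul (hL.orderLE_gen_mul_D_sub k)).mul hS
    exact h2.sub h3
  have hXS : ∀ k : ℕ+, dt k S = S * X k + hL.gen k * D * S - S * sh (k : ℕ) := by
    intro k
    simp only [X]
    rw [mul_add, mul_sub, ← mul_assoc, ← mul_assoc, ← mul_assoc, hST, one_mul, one_mul]
    abel
  have hXc : ∀ k, X k = ofCoeff fun l => (X k).1 (-(l : ℤ)) 0 := fun k => eq_ofCoeff (hXo k) (hXsh k)
  have hclosed := hL.dt_logDeriv hTS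
    (fun j k => UpperOp.ext (mul_comm_of_const (const_of_commute_sh (hXsh j))
      (const_of_commute_sh (hXsh k))))
    (fun j k => commute_sh_of_commute_sh_one (hXsh k) j) hXS
  obtain ⟨c, hc0, hc⟩ := MvPowerSeries.exists_pderiv_eq_sum_antidiagonal
    (fun (k : ℕ+) (l : ℕ) => -(X k).1 (-(l : ℤ)) 0) (fun i j l => by
      rw [map_neg, map_neg]
      exact congrArg Neg.neg (congrFun (congrFun (congrArg val (hclosed i j)) _) _))
  have hC0 : ∀ n, IsUnit ((ofCoeff c).1 0 n) := fun n => hc0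
  obtain ⟨C', hC', hCC', hC'C⟩ := exists_inv (orderLE_ofCoeff c) hC0
  -- Right multiplication of `S` by this gauge factor cancels the defect `X_k`.
  have hCd : ∀ k, dt k (ofCoeff c) = -(X k * ofCoeff c) := by
    intro k
    refine UpperOp.ext <| DiffOp.ext fun m n => ?_
    rw [hXc k, UpperOp.coe_neg, DiffOp.neg_apply]
    rcases lt_or_ge 0 m with hm | hm
    · rw [coe_dt, (orderLE_ofCoeff c).timeDeriv k m n hm, UpperOp.coe_mul,
        (orderLE_ofCoeff _).mul (orderLE_ofCoeff c) m n (by omega), neg_zero]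
    · obtain ⟨l, rfl⟩ : ∃ l : ℕ, m = -(l : ℤ) := ⟨(-m).toNat, by omega⟩
      rw [ofCoeff_mul_ofCoeff_apply, coe_dt, timeDeriv, ofCoeff_apply, hc,
        ← Finset.sum_neg_distrib]
      simp only [neg_mul]
  refine ⟨S * ofCoeff c, C' * T, hC'.mul hT, hS.mul (orderLE_ofCoeff c), ?_, ?_, ?_, fun k => ?_⟩
  · rw [mul_assoc, ← mul_assoc _ C', hCC', one_mul, hST]
  · rw [mul_assoc, ← mul_assoc T, hTS, one_mul, hC'C]
  · rw [← mul_assoc, hLS, mul_assoc, mul_assoc, (commute_sh_ofCoeff c 1).eq]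
  · rw [dt_mul, hCd, hXS, mul_assoc S (ofCoeff c), ← (commute_sh_ofCoeff c _).eq]
    noncomm_ring

theorem IsDressing.pos_pow_mul {hL : IsLaxPair Lp Lm} {S T : UpperOp} (h : hL.IsDressing S T)
    (k : ℕ) : hL.pos ^ k = S * sh k * T := by
  have h1 : hL.pos = S * sh 1 * T := by rw [← h.dressing, mul_assoc, h.mul_inv, mul_one]
  induction k with
  | zero => rw [pow_zero, Nat.cast_zero, sh_zero, mul_one, h.mul_inv]
  | succ k ih =>
    have : S * sh k * T * (S * sh 1 * T) = S * sh k * (T * S) * sh 1 * T := by noncomm_ring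
    rw [pow_succ, ih, h1, this, h.inv_mul, mul_one, mul_assoc S, sh_mul_sh, Nat.cast_succ]

/-- `S⁻ = Λ S⁻¹ ι` has inverse `D S Λ⁻¹`; conditions on `L⁻` are checked on adjoints, where `(L⁻)^*
= (S⁻)⁻¹ Λ S⁻`. -/
theorem IsDressing.isWavePair {hL : IsLaxPair Lp Lm} {S T : UpperOp} (h : hL.IsDressing S T)
    (hSm : OrderLE 0 (sh 1 * T * iota).1) : IsWavePair Lp Lm S.1 (sh 1 * T * iota).1 where
  orderLE_pos := h.orderLE
  orderLE_neg := hSm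
  dressing_pos := by
    refine ⟨T.1, ⟨T.2, congrArg val h.mul_inv, congrArg val h.inv_mul⟩, ?_⟩
    have := h.pos_pow_mul 1
    rw [pow_one] at this
    exact congrArg val this
  dressing_neg := by
    have h1 : D * S * sh (-1) * (sh 1 * T * iota) = 1 := by
      have : D * S * sh (-1) * (sh 1 * T * iota) = D * S * (sh (-1) * sh 1) * T * iota := by
        noncomm_ring
      rw [this, sh_mul_sh, neg_add_cancel, sh_zero, mul_one, mul_assoc D, h.mul_inv, mul_one,
        D_mul_iota]
    have h2 : sh 1 * T * iota * (D * S * sh (-1)) = 1 := by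
      have : sh 1 * T * iota * (D * S * sh (-1)) = sh 1 * T * (iota * D) * S * sh (-1) := by
        noncomm_ring
      rw [this, iota_mul_D, mul_one, mul_assoc (sh 1), h.inv_mul, mul_one, sh_mul_sh,
        add_neg_cancel, sh_zero]
    refine ⟨adj (D * S * sh (-1) : UpperOp).1, ⟨⟨_, (D * S * sh (-1)).2.choose_spec.adj⟩, ?_, ?_⟩, ?_⟩
    · rw [← DiffOp.adj_mul, ← UpperOp.coe_mul, h1]
      exact adj_one
    · rw [← DiffOp.adj_mul, ← UpperOp.coe_mul, h2]
      exact adj_one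
    · refine adj_injective ?_
      rw [DiffOp.adj_mul, DiffOp.adj_mul, adj_adj, adj_adj, adj_shift, neg_neg]
      have h3 : hL.negAdj = D * S * sh (-1) * (sh 1 * (sh 1 * T * iota)) := by
        have e : D * S * sh (-1) * (sh 1 * (sh 1 * T * iota)) =
            D * (S * (sh (-1) * sh 1 * sh 1) * T) * iota := by noncomm_ring
        have h4 := h.pos_pow_mul 1
        rw [pow_one] at h4
        rw [hL.negAdj_eq, h4, e, sh_mul_sh, neg_add_cancel, sh_zero, one_mul, Nat.cast_one]
      exact congrArg val h3
  constraint := by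
    have e : S * sh (-1) * (sh 1 * T * iota) = S * (sh (-1) * sh 1) * T * iota := by noncomm_ring
    rw [sh_mul_sh, neg_add_cancel, sh_zero, mul_one, h.mul_inv, one_mul] at e
    exact congrArg val e
  sato_pos k := by
    rw [hL.flowGen_eq]
    exact congrArg val (h.sato k)
  sato_neg k := by
    rw [hL.adj_flowGen]
    have hι : dt k iota = 0 := by
      have hD : dt k D = 0 := by rw [D, dt_sub, dt_sh, dt_sh, sub_zero]
      rw [dt_inv iota_mul_D D_mul_iota, hD, mul_zero, zero_mul, neg_zero]
    have e : dt k (sh 1 * T * iota) =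
        sh (k : ℕ) * (sh 1 * T * iota) + sh 1 * T * iota * -(D * hL.gen k) := by
      have e1 : T * (hL.gen k * D * S - S * sh (k : ℕ)) * T =
          T * hL.gen k * D * (S * T) - (T * S) * sh (k : ℕ) * T := by noncomm_ring
      have e2 : sh 1 * T * iota * -(D * hL.gen k) = -(sh 1 * T * (iota * D) * hL.gen k) := by
        noncomm_ring
      have e3 : sh 1 * -(T * hL.gen k * D - sh (k : ℕ) * T) * iota =
          sh 1 * sh (k : ℕ) * T * iota - sh 1 * T * hL.gen k * (D * iota) := by noncomm_ring
      rw [dt_mul, hι, mul_zero, add_zero, dt_mul, dt_sh, zero_mul, zero_add,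
        dt_inv h.inv_mul h.mul_inv, h.sato, e1, h.mul_inv, h.inv_mul, mul_one, one_mul, e2,
        iota_mul_D, mul_one, e3, D_mul_iota, mul_one, sh_mul_sh, add_comm (1 : ℤ), ← sh_mul_sh]
      noncomm_ring
    exact congrArg val e
  flowGen_eq k := by
    have e : S * sh (((k : ℕ) : ℤ) - 1) * (sh 1 * T * iota) = hL.pos ^ (k : ℕ) * iota := by
      have : S * sh (((k : ℕ) : ℤ) - 1) * (sh 1 * T * iota) =
        S * (sh (((k : ℕ) : ℤ) - 1) * sh 1) * T * iota := by noncomm_ring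
      rw [this, sh_mul_sh, sub_add_cancel, h.pos_pow_mul]
    have e' := congrArg val e
    rw [hL.flowGen_eq]
    change _ = DiffOp.symPart ((S * sh (((k : ℕ) : ℤ) - 1) * (sh 1 * T * iota) : UpperOp).1) *
      shiftDiff
    rw [e']
    rfl

theorem exists_isDressing_of_isWavePair (hL : IsLaxPair Lp Lm) {Sp Sm : DiffOp}
    (h : IsWavePair Lp Lm Sp Sm) : ∃ S T : UpperOp, hL.IsDressing S T ∧ OrderLE 0 T.1 ∧
      Sp = S.1 ∧ Sm = (sh 1 * T * iota).1 := by
  obtain ⟨T, ⟨hT, hST, hTS⟩, hLS⟩ := h.dressing_pos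
  let S' : UpperOp := ⟨Sp, 0, h.orderLE_pos⟩
  let T' : UpperOp := ⟨T, hT⟩
  let M' : UpperOp := ⟨Sm, 0, h.orderLE_neg⟩
  have hST' : S' * T' = 1 := UpperOp.ext hST
  have hTS' : T' * S' = 1 := UpperOp.ext hTS
  have hLS' : hL.pos = S' * sh 1 * T' := UpperOp.ext hLS
  have hc : S' * sh (-1) * M' = iota := UpperOp.ext h.constraint
  have hM : M' = sh 1 * T' * iota := by
    have : sh 1 * T' * (S' * sh (-1) * M') = sh 1 * (T' * S') * sh (-1) * M' := by noncomm_ring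
    rw [← hc, this, hTS', mul_one, sh_mul_sh, add_neg_cancel, sh_zero, one_mul]
  -- An inverse is only known to be bounded above; this formula and the order of `S⁻` bound it by
  -- `-1 + 0 + 1 = 0`.
  have hTM : T' = sh (-1) * M' * D := by
    have : sh (-1) * (sh 1 * T' * iota) * D = sh (-1) * sh 1 * T' * (iota * D) := by noncomm_ring
    rw [hM, this, sh_mul_sh, neg_add_cancel, sh_zero, one_mul, iota_mul_D, mul_one]
  refine ⟨S', T', ⟨h.orderLE_pos, hST', hTS', ?_, fun k => ?_⟩, ?_, rfl, congrArg val hM⟩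
  · rw [hLS', mul_assoc, hTS', mul_one]
  · have e := h.sato_pos k
    rw [hL.flowGen_eq] at e
    exact UpperOp.ext e
  · rw [hTM]
    exact ((orderLE_shift (-1)).mul h.orderLE_neg).mul orderLE_D

/-- In `∂_k (S⁻¹ S')` the `B_k` terms cancel, and the `Λ^k` terms cancel because the quotient
commutes with `Λ`. -/
theorem IsDressing.exists_constOp {hL : IsLaxPair Lp Lm} {S T S' T' : UpperOp}
    (h : hL.IsDressing S T) (h' : hL.IsDressing S' T') (hT : OrderLE 0 T.1) :
    ∃ c, T * S' = constOp c := by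
  have hcomm : Commute (sh 1) (T * S') := by
    have h1 : T * hL.pos = sh 1 * T := by
      have := h.pos_pow_mul 1
      rw [pow_one] at this
      rw [this, ← mul_assoc, ← mul_assoc, h.inv_mul, one_mul, Nat.cast_one]
    rw [Commute, SemiconjBy, ← mul_assoc, ← h1, mul_assoc, h'.dressing, mul_assoc]
  obtain ⟨c, hc⟩ := eq_constNeg (A := T * S') (hT.mul h'.orderLE) hcomm fun k => by
    have e : -(T * (hL.gen k * D * S - S * sh (k : ℕ)) * T) * S' +
        T * (hL.gen k * D * S' - S' * sh (k : ℕ)) =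
        T * S * (sh (k : ℕ) * (T * S')) - T * S' * sh (k : ℕ)
          - T * hL.gen k * D * (S * T) * S' + T * hL.gen k * D * S' := by
      noncomm_ring
    rw [dt_mul, dt_inv h.inv_mul h.mul_inv, h.sato, h'.sato, e, h.mul_inv, h.inv_mul, one_mul,
      mul_one, (commute_sh_of_commute_sh_one hcomm _).eq]
    abel
  exact ⟨c, UpperOp.ext hc⟩

end IsLaxPair

/-- The constants are the quotients `S⁻¹ S'` and `S'⁻¹ S`. Since `S⁻ = Λ S⁻¹ ι`, the second
multiplies `S⁻` on the left, hence its adjoint on the right. -/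
theorem wavePair_iff {Lp Lm : DiffOp} (hL : IsLaxPair Lp Lm) {Sp Sm : DiffOp}
    (h : IsWavePair Lp Lm Sp Sm) (Sp' Sm' : DiffOp) : IsWavePair Lp Lm Sp' Sm' ↔
      ∃ cp cm : ℕ → ℂ, constNeg cp * adj (constPos cm) = 1 ∧
        Sp' = Sp * constNeg cp ∧ adj Sm' = adj Sm * constPos cm := by
  obtain ⟨S, T, hD, hT, rfl, rfl⟩ := hL.exists_isDressing_of_isWavePair h
  simp only [adj_constPos]
  constructor
  · intro h'
    obtain ⟨S', T', hD', hT', rfl, rfl⟩ := hL.exists_isDressing_of_isWavePair h'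
    obtain ⟨c, hc⟩ := hD.exists_constOp hD' hT
    obtain ⟨d, hd⟩ := hD'.exists_constOp hD hT'
    refine ⟨c, d, ?_, ?_, ?_⟩
    · have : constOp c * constOp d = 1 := by
        rw [← hc, ← hd, mul_assoc, ← mul_assoc S', hD'.mul_inv, one_mul, hD.inv_mul]
      exact congrArg val this
    · have : S' = S * constOp c := by rw [← hc, ← mul_assoc, hD.mul_inv, one_mul]
      exact congrArg val this
    · have : sh 1 * T' * iota = constOp d * (sh 1 * T * iota) := by
        have e : constOp d * (sh 1 * T * iota) = constOp d * sh 1 * T * iota := by noncomm_ring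
        have e' : sh 1 * (T' * S) * T * iota = sh 1 * T' * (S * T) * iota := by noncomm_ring
        rw [e, ← (commute_sh_constOp d 1).eq, ← hd, e', hD.mul_inv, mul_one]
      rw [← adj_constNeg, ← DiffOp.adj_mul]
      exact congrArg adj (congrArg val this)
  · rintro ⟨c, d, hcd, rfl, hSm⟩
    rw [← adj_constNeg, ← DiffOp.adj_mul] at hSm
    have hcd' : constOp c * constOp d = 1 := UpperOp.ext hcd
    have hdc' : constOp d * constOp c = 1 := by
      rw [← hcd']
      exact UpperOp.ext (mul_comm_of_const (fun _ _ _ => rfl) fun _ _ _ => rfl)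
    have hSm' : Sm' = (sh 1 * (constOp d * T) * iota).1 := by
      have : constOp d * (sh 1 * T * iota) = sh 1 * (constOp d * T) * iota := by
        have e : constOp d * (sh 1 * T * iota) = constOp d * sh 1 * T * iota := by noncomm_ring
        rw [e, ← (commute_sh_constOp d 1).eq, mul_assoc (sh 1)]
      rw [← this]
      exact adj_injective hSm
    have hD' : hL.IsDressing (S * constOp c) (constOp d * T) := by
      refine ⟨hD.orderLE.mul (orderLE_constNeg c), ?_, ?_, ?_, fun k => ?_⟩
      · rw [mul_assoc, ← mul_assoc (constOp c), hcd', one_mul, hD.mul_inv]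
      · rw [mul_assoc, ← mul_assoc T, hD.inv_mul, one_mul, hdc']
      · rw [← mul_assoc, hD.dressing, mul_assoc, mul_assoc, (commute_sh_constOp c 1).eq]
      · rw [dt_mul, dt_constOp, mul_zero, add_zero, hD.sato, mul_assoc S (constOp c),
          ← (commute_sh_constOp c _).eq]
        noncomm_ring
    rw [hSm']
    refine hD'.isWavePair ?_
    exact ((orderLE_shift 1).mul ((orderLE_constNeg d).mul hT)).mul orderLE_iota

end LargeBKP

end

theorem mainTheorem4 (Lp Lm : LargeBKP.DiffOp) (hL : LargeBKP.IsLaxPair Lp Lm)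
    (hu : ∀ n : ℤ, IsUnit (Lp 1 n)) :
    (∃ Sp Sm : LargeBKP.DiffOp, LargeBKP.IsWavePair Lp Lm Sp Sm) ∧
    ∀ Sp Sm : LargeBKP.DiffOp, LargeBKP.IsWavePair Lp Lm Sp Sm →
      ∀ Sp' Sm' : LargeBKP.DiffOp, LargeBKP.IsWavePair Lp Lm Sp' Sm' ↔
        ∃ cp cm : ℕ → ℂ,
          LargeBKP.DiffOp.constNeg cp * LargeBKP.DiffOp.adj (LargeBKP.DiffOp.constPos cm) = 1 ∧
          Sp' = Sp * LargeBKP.DiffOp.constNeg cp ∧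
          LargeBKP.DiffOp.adj Sm' = LargeBKP.DiffOp.adj Sm * LargeBKP.DiffOp.constPos cm := by
  refine ⟨?_, fun Sp Sm h Sp' Sm' => LargeBKP.wavePair_iff hL h Sp' Sm'⟩
  obtain ⟨S, T, hT, hD⟩ := hL.exists_isDressing hu
  exact ⟨_, _, hD.isWavePair
    (((LargeBKP.DiffOp.orderLE_shift 1).mul hT).mul LargeBKP.UpperOp.orderLE_iota)⟩
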